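/- Let $T$ be a complete first-order theory in a language $L$, and let $\mathcal C$ be a monster model of $T$: for some uncountable cardinal $\kappa>|L|$ it is $\kappa$-saturated and strongly $\kappa$-homogeneous. "Small" means of cardinality $<\kappa$; models are small elementary submodels of $\mathcal C$, and formulas, types and parameters are taken in $\mathcal C^{eq}$. **Definitions.** For $A\subseteq N$, $N$ a model (or $N=\mathcal C$), $acl^N(A)$ is the union of the finite $A$-definable subsets of $N$; for a finite real tuple $a$, $\dim^{\rm alg}(a/B)$ is the largest size of a set of coordinates of $a$ that is algebraically independent over $B$. A model $M$ is *weakly $\omega$-saturated* if, whenever $c$ is a tuple in $M$ and $\varphi(x_1,\dots,x_n;c)$ has a solution $a$ in $\mathcal C$ with $a_i\notin acl(a_{i+1},\dots,a_n,c)$ for all $i$, it has a solution $b$ in $M$ with $b_i\notin acl^M(b_{i+1},\dots,b_n,c)$ for all $i$. $T$ has *weak (geometric) elimination of imaginaries* if for every $e\in\mathcal C^{eq}$ there is a finite set $x$ of real elements with $acl^{eq}(e)=acl^{eq}(x)$. A formula $\delta(x,a)$ *strongly divides over $A$* if $tp(a/A)$ is non-algebraic and $\{\delta(x,a'):a'\models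 tp(a/A)\}$ is $k$-inconsistent for some $k\in\mathbb N$; it *þ-divides over $A$* if it strongly divides over $Ac$ for some tuple $c$; a formula *þ-forks over $A$* if it implies a finite disjunction of formulas that þ-divide over $A$; a type þ-forks over $A$ if it contains a formula that does. $T$ is *þ-minimal* if for every model $N$, every element $a\in N$ and every $A\subseteq N$, $tp(a/A)$ þ-forks over $\emptyset$ if and only if $a$ is algebraic over $A$ but not over $\emptyset$. $U^{\text{þ}}(a/A)=U^{\text{þ}}(tp(a/A))$ is the foundation rank of þ-forking: it is always $\ge 0$; it is $\ge\alpha+1$ iff $tp(a/A)$ has an extension over some small $B\supseteq A$ that þ-forks over $A$ and has $U^{\text{þ}}\ge\alpha$; it is $\ge\lambda$ ($\lambda$ limit) iff it is $\ge\alpha$ for all $\alpha<\lambda$. The global $U^{\text{þ}}$-rank is the supremum of $U^{\text{þ}}(a/A)$ over single real elements $a$ and small $A$. For a formula $\varphi(x)$ with parameters, a set $\Delta$ of formulas in $x;y$, a set $\Pi$ of formulas in $y;z$ and $k\in\mathbb N$, the þ-rank is defined by: þ$(\varphi,\Delta,\Pi,k)\ge 0$ iff $\varphi$ is consistent; $\ge\alpha+1$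 iff there are $\delta\in\Delta$, $\pi\in\Pi$ and $c$ such that þ$(\varphi\wedge\delta(x,a),\Delta,\Pi,k)\ge\alpha$ for infinitely many $a\models\pi(y;c)$ and $\{\delta(x,a)\}_{a\models\pi(y;c)}$ is $k$-inconsistent; $\ge\lambda$ ($\lambda$ limit) iff $\ge\alpha$ for all $\alpha<\lambda$. $T$ is *rosy* if all its þ-ranks are defined (are not $\infty$). **Theorem.** Let $M$ be a model of $T$, so that $T=Th(M)$, which is weakly $\omega$-saturated, in which algebraic closure satisfies the Steinitz exchange property, and such that $T$ has weak (geometric) elimination of imaginaries. Then: 1. $T$ is þ-minimal. 2. If $M$ is infinite, then $T$ has global $U^{\text{þ}}$-rank $1$. 3. $U^{\text{þ}}(a/B)=\dim^{\rm alg}(a/B)$ for every finite real tuple $a$ and every small real set $B$; in particular $U^{\text{þ}}(a)=\dim^{\rm alg}(a)$. 4. $T$ is rosy. 5. þ-forking coincides with algebraic independence: for every finite real tuple $a$ and all small real sets $A,B$, $tp(a/AB)$ does not þ-fork over $A$ if and only if $\dim^{\rm alg}(a/AB)=\dim^{\rm alg}(a/A)$. -/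

import Mathlib

open FirstOrder Cardinal

universe u v w

namespace ThornForking

noncomputable section

/-! ## Monster models and real algebraic closure -/

/-- `C` is a monster model (of its complete theory) at the uncountable cardinal `κ > |L|`:
it is `κ`-saturated and strongly `κ`-homogeneous. A set is *small* if its cardinality is `< κ`. -/
structure IsMonster (L : FirstOrder.Language.{v, w}) (C : Type u) [L.Structure C] (κ : Cardinal.{u}) :
    Prop where
  aleph0_lt : ℵ₀ < κ
  card_lt : Cardinal.lift.{u} L.card < Cardinal.lift.{max v w} κ
  /-- a finitely satisfiable set of formulas in one variable over a small set is realised -/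
  saturated : ∀ A : Set C, #A < κ → ∀ p : Set (L[[A]].Formula Unit),
    (∀ q : Finset (L[[A]].Formula Unit), (q : Set (L[[A]].Formula Unit)) ⊆ p →
      ∃ a : C, ∀ φ ∈ q, φ.Realize (fun _ => a)) →
    ∃ a : C, ∀ φ ∈ p, φ.Realize (fun _ => a)
  /-- an elementary map with small domain extends to an automorphism -/
  homogeneous : ∀ A : Set C, #A < κ → ∀ f : A → C,
    (∀ φ : L.Formula A, φ.Realize (fun a : A => (a : C)) ↔ φ.Realize f) →
    ∃ g : C ≃[L] C, ∀ a : A, g a = f a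

/-- The algebraic closure, in the structure `N`, of a set `A` of elements of `N`: the union of
all finite subsets of `N` definable over `A`. -/
def acl (L : FirstOrder.Language.{v, w}) {N : Type u} [L.Structure N] (A : Set N) : Set N :=
  {b | ∃ X : Set N, A.Definable₁ L X ∧ X.Finite ∧ b ∈ X}

/-- Algebraic closure in `N` satisfies the Steinitz exchange property. -/
def SteinitzExchange (L : FirstOrder.Language.{v, w}) (N : Type u) [L.Structure N] : Prop :=
  ∀ (A : Set N) (a b : N), a ∈ acl L (insert b A) → a ∉ acl L A → b ∈ acl L (insert a A)

/-- `B`-independence of a set for algebraic closure. -/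
def AlgIndependent (L : FirstOrder.Language.{v, w}) {N : Type u} [L.Structure N] (B S : Set N) : Prop :=
  ∀ s ∈ S, s ∉ acl L (B ∪ (S \ {s}))

/-- The algebraic dimension `dim^alg(a/B)` of a finite tuple `a` over `B`: the largest size of a
set of coordinates of `a` that is algebraically independent over `B`. -/
def algDim (L : FirstOrder.Language.{v, w}) {N : Type u} [L.Structure N] (B : Set N) {n : ℕ}
    (a : Fin n → N) : ℕ :=
  sSup {d | ∃ S : Finset N, (S : Set N) ⊆ Set.range a ∧ AlgIndependent L B S ∧ S.card = d}

/-- The elementary submodel `M` of the monster model `C` is weakly `ω`-saturated: whenever a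
formula `φ(x₁,…,xₙ; c)` with `c` a tuple in `M` has a solution `a` in `C` such that
`aᵢ ∉ acl(aᵢ₊₁,…,aₙ,c)` for all `i`, it has a solution `b` in `M` such that
`bᵢ ∉ acl^M(bᵢ₊₁,…,bₙ,c)` for all `i`. -/
def WeaklyOmegaSaturated {L : FirstOrder.Language.{v, w}} {C : Type u} [L.Structure C]
    (M : L.ElementarySubstructure C) : Prop :=
  ∀ (m n : ℕ) (c : Fin m → M) (φ : L.Formula (Fin n ⊕ Fin m)),
    (∃ a : Fin n → C, φ.Realize (Sum.elim a (fun j => (c j : C))) ∧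
      ∀ i, a i ∉ acl L (a '' Set.Ioi i ∪ Set.range (fun j => (c j : C)))) →
    ∃ b : Fin n → M, φ.Realize (Sum.elim b c) ∧
      ∀ i, b i ∉ acl L (b '' Set.Ioi i ∪ Set.range c)

/-! ## Imaginaries: the structure `C^eq` -/

/-- A sort of `C^eq`: a `∅`-definable equivalence relation `E` on a finite power of `C`. -/
structure ImagSort (L : FirstOrder.Language.{v, w}) (C : Type u) [L.Structure C] where
  arity : ℕ
  rel : Setoid (Fin arity → C)
  definable : (∅ : Set C).Definable L
    {v : Fin arity ⊕ Fin arity → C | rel (fun i => v (Sum.inl i)) (fun i => v (Sum.inr i))}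

section

variable {L : FirstOrder.Language.{v, w}} {C : Type u} [L.Structure C]

/-- The elements of the sort `S` of `C^eq`: the classes of its equivalence relation. -/
abbrev ImagSort.Elem (S : ImagSort L C) : Type u := Quotient S.rel

/-- The class of a tuple. -/
def ImagSort.cls (S : ImagSort L C) (v : Fin S.arity → C) : S.Elem := Quotient.mk S.rel v

variable (L C) in
/-- The universe of `C^eq`. A finite tuple of imaginaries is again an imaginary, since a finite
product of `∅`-definable equivalence relations is one; so finite tuples of `C^eq` are
represented by single elements. -/
abbrev Imag : Type u := Σ S : ImagSort L C, S.Elem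

theorem definable_eq_tuple (n : ℕ) : (∅ : Set C).Definable L
    {v : Fin n ⊕ Fin n → C | (fun i => v (Sum.inl i)) = (fun i => v (Sum.inr i))} := by
  have h : {v : Fin n ⊕ Fin n → C | (fun i => v (Sum.inl i)) = (fun i => v (Sum.inr i))}
      = ⋂ i : Fin n, {v : Fin n ⊕ Fin n → C | v (Sum.inl i) = v (Sum.inr i)} := by
    ext v
    simp [funext_iff]
  rw [h]
  refine Set.definable_iInter_of_finite fun i => ?_
  rw [Set.empty_definable_iff]
  refine ⟨FirstOrder.Language.Term.equal (FirstOrder.Language.Term.var (Sum.inl i)) (FirstOrder.Language.Term.var (Sum.inr i)), ?_⟩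
  ext v
  simp

variable (L C) in
/-- The sort of real `n`-tuples. -/
def realSort (n : ℕ) : ImagSort L C where
  arity := n
  rel := ⊥
  definable := definable_eq_tuple n

/-- A real tuple as an element of `C^eq`. -/
def realTuple (L : FirstOrder.Language.{v, w}) {C : Type u} [L.Structure C] {n : ℕ} (a : Fin n → C) :
    (realSort L C n).Elem :=
  (realSort L C n).cls a

/-- A set of real elements as a subset of `C^eq`. -/
def realSet (L : FirstOrder.Language.{v, w}) {C : Type u} [L.Structure C] (A : Set C) : Set (Imag L C) :=
  (fun a => ⟨realSort L C 1, realTuple L (fun _ => a)⟩) '' A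

/-- An `L^eq`-formula `δ(x; y)` without parameters, up to equivalence, with `x` of sort `S` and
`y` of sort `S'`: a relation whose pull-back to `C` is `∅`-definable. -/
structure EqFormula (S S' : ImagSort L C) where
  holds : S.Elem → S'.Elem → Prop
  definable : (∅ : Set C).Definable L {v : Fin S.arity ⊕ Fin S'.arity → C |
    holds (S.cls fun i => v (Sum.inl i)) (S'.cls fun i => v (Sum.inr i))}

/-- The set of solutions of `δ(x, a)`. -/
def EqFormula.solutions {S S' : ImagSort L C} (δ : EqFormula S S') (a : S'.Elem) : Set S.Elem :=
  {x | δ.holds x a}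

/-- `X`, a subset of the sort `S`, is definable in `C^eq` with parameters from `A ⊆ C^eq`: it is
defined by `φ(x; e₁,…,eₘ)` for some `L^eq`-formula `φ` and some `e₁,…,eₘ ∈ A`. -/
def EqDefinable (A : Set (Imag L C)) {S : ImagSort L C} (X : Set S.Elem) : Prop :=
  ∃ (m : ℕ) (e : Fin m → Imag L C), (∀ i, e i ∈ A) ∧
    ∃ φ : S.Elem → (∀ i, (e i).1.Elem) → Prop,
      (∅ : Set C).Definable L {v : Fin S.arity ⊕ (Σ i, Fin (e i).1.arity) → C |
        φ (S.cls fun j => v (Sum.inl j)) (fun i => (e i).1.cls fun j => v (Sum.inr ⟨i, j⟩))} ∧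
      X = {x | φ x (fun i => (e i).2)}

/-- `a'` realises `tp(a/A)`, for `a`, `a'` in the same sort of `C^eq` and `A ⊆ C^eq`. -/
def RealizesType {S : ImagSort L C} (A : Set (Imag L C)) (a a' : S.Elem) : Prop :=
  ∀ X : Set S.Elem, EqDefinable A X → a ∈ X → a' ∈ X

/-- The algebraic closure in `C^eq`: `e ∈ acl^eq(A)` if and only if `tp(e/A)` is algebraic. -/
def aclEq (A : Set (Imag L C)) : Set (Imag L C) :=
  {e | ∃ X : Set e.1.Elem, EqDefinable A X ∧ X.Finite ∧ e.2 ∈ X}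

variable (L C) in
/-- Geometric elimination of imaginaries: every imaginary is interalgebraic, in `C^eq`, with a
finite set of real elements. -/
def GeometricEI : Prop :=
  ∀ e : Imag L C, ∃ x : Finset C, aclEq {e} = aclEq (realSet L (x : Set C))

/-! ## þ-forking -/

/-- `{δ(x, a')}`, for `a'` ranging over `P`, is `k`-inconsistent: no `k` instances at distinct
parameters have a common solution. -/
def KInconsistent {S S' : ImagSort L C} (δ : EqFormula S S') (P : Set S'.Elem) (k : ℕ) : Prop :=
  ∀ f : Fin k → S'.Elem, Function.Injective f → (∀ i, f i ∈ P) → ¬ ∃ x, ∀ i, δ.holds x (f i)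

/-- `δ(x, a)` strongly divides over `A`. -/
def StronglyDivides {S S' : ImagSort L C} (δ : EqFormula S S') (a : S'.Elem)
    (A : Set (Imag L C)) : Prop :=
  (⟨S', a⟩ : Imag L C) ∉ aclEq A ∧ ∃ k : ℕ, KInconsistent δ {a' | RealizesType A a a'} k

/-- `δ(x, a)` þ-divides over `A`: it strongly divides over `Ac` for some tuple `c`. -/
def ThornDivides {S S' : ImagSort L C} (δ : EqFormula S S') (a : S'.Elem)
    (A : Set (Imag L C)) : Prop :=
  ∃ c : Imag L C, StronglyDivides δ a (insert c A)

/-- The formula with solution set `X` þ-forks over `A`: it implies a finite disjunction of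
formulas that þ-divide over `A`. -/
def ThornForks {S : ImagSort L C} (X : Set S.Elem) (A : Set (Imag L C)) : Prop :=
  ∃ (m : ℕ) (S' : Fin m → ImagSort L C) (δ : ∀ i, EqFormula S (S' i)) (a : ∀ i, (S' i).Elem),
    (∀ i, ThornDivides (δ i) (a i) A) ∧ X ⊆ ⋃ i, (δ i).solutions (a i)

/-- `tp(a/B)` þ-forks over `A`: some formula in `tp(a/B)` does. -/
def TypeThornForks {S : ImagSort L C} (a : S.Elem) (B A : Set (Imag L C)) : Prop :=
  ∃ X : Set S.Elem, EqDefinable B X ∧ a ∈ X ∧ ThornForks X A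

/-! ## þ-minimality, U^þ-rank and rosiness -/

variable (L C) in
/-- The theory of the monster model `C` is þ-minimal: for every element `a` of a model and every
subset `A` of that model, `tp(a/A)` þ-forks over `∅` if and only if `a` is algebraic over `A`
but not over `∅`. (Models are small elementary submodels of `C`.) -/
def ThornMinimal (κ : Cardinal.{u}) : Prop :=
  ∀ (N : L.ElementarySubstructure C), #N < κ → ∀ (a : N) (A : Set N),
    TypeThornForks (realTuple L (fun _ : Fin 1 => (a : C)))
        (realSet L ((fun x : N => (x : C)) '' A)) ∅ ↔
      a ∈ acl L A ∧ a ∉ acl L (∅ : Set N)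

/-- `U^þ(tp(a/A)) ≥ α`, by recursion on the ordinal `α`:
`≥ 0` always; `≥ α + 1` if and only if `tp(a/A)` has an extension `tp(a'/B)` to a small set
`B ⊇ A` that þ-forks over `A` and has `U^þ(tp(a'/B)) ≥ α`; `≥ λ`, for `λ` limit, if and only
if `≥ α` for all `α < λ`. -/
def ThornUGE (κ : Cardinal.{u}) (S : ImagSort L C) (α : Ordinal.{u}) :
    Set (Imag L C) → S.Elem → Prop :=
  Ordinal.limitRecOn (motive := fun _ => Set (Imag L C) → S.Elem → Prop) α
    (fun _ _ => True)
    (fun _ ge A a => ∃ (B : Set (Imag L C)) (a' : S.Elem), A ⊆ B ∧ #B < κ ∧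
      RealizesType A a a' ∧ TypeThornForks a' B A ∧ ge B a')
    (fun l _ ge A a => ∀ (β : Ordinal.{u}) (hβ : β < l), ge β hβ A a)

/-- The rank `U^þ(tp(a/A))`, an ordinal or `∞ = ⊤`. -/
def thornU (κ : Cardinal.{u}) {S : ImagSort L C} (A : Set (Imag L C)) (a : S.Elem) :
    WithTop Ordinal.{u} :=
  sSup {x | ∃ α : Ordinal.{u}, x = (α : WithTop Ordinal.{u}) ∧ ThornUGE κ S α A a}

variable (L C) in
/-- The global `U^þ`-rank: the supremum of `U^þ(tp(a/A))` over all single real elements `a` and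
all small sets `A`. -/
def globalThornU (κ : Cardinal.{u}) : WithTop Ordinal.{u} :=
  ⨆ (A : Set (Imag L C)) (_ : #A < κ) (a : C), thornU κ A (realTuple L (fun _ : Fin 1 => a))

/-- `þ(φ, Δ, Θ, k) ≥ α`, by recursion on the ordinal `α`, where `X` is the solution set of `φ`,
`Δ` is a set of formulas in `x; y` and `Θ` a set of formulas in `y; z`. The variables `z` may form
an infinite tuple; as each formula uses only a finite part of it, the sort of that part is
recorded with the formula. -/
def ThornRankGE {S S' : ImagSort L C} (Δ : Set (EqFormula S S'))
    (Θ : Set (Σ S'' : ImagSort L C, EqFormula S' S'')) (k : ℕ) (α : Ordinal.{u}) :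
    Set S.Elem → Prop :=
  Ordinal.limitRecOn (motive := fun _ => Set S.Elem → Prop) α
    (fun X => X.Nonempty)
    (fun _ ge X => ∃ δ ∈ Δ, ∃ π ∈ Θ, ∃ c : π.1.Elem,
      {a | π.2.holds a c ∧ ge (X ∩ δ.solutions a)}.Infinite ∧
      KInconsistent δ (π.2.solutions c) k)
    (fun l _ ge X => ∀ (β : Ordinal.{u}) (hβ : β < l), ge β hβ X)

variable (L C) in
/-- The theory of `C` is rosy: all þ-ranks `þ(φ, Δ, Θ, k)` are defined, that is, are not `∞`.
Here `Δ` and `Θ` are arbitrary sets of formulas, in particular arbitrary finite ones. -/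
def Rosy : Prop :=
  ∀ (S S' : ImagSort L C) (X : Set S.Elem), EqDefinable Set.univ X →
    ∀ (Δ : Set (EqFormula S S')) (Θ : Set (Σ S'' : ImagSort L C, EqFormula S' S'')) (k : ℕ),
      ∃ α : Ordinal.{u}, ¬ ThornRankGE Δ Θ k α X

variable (L C) in
/-- þ-forking coincides with algebraic independence: for every finite real tuple `a` and all small
real sets `A`, `B`, the type `tp(a/AB)` does not þ-fork over `A` if and only if `a` is
algebraically independent of `B` over `A`, that is, `dim^alg(a/AB) = dim^alg(a/A)`. -/
def ThornIndepIffAlgIndep (κ : Cardinal.{u}) : Prop :=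
  ∀ (n : ℕ) (a : Fin n → C) (A B : Set C), #A < κ → #B < κ →
    (¬ TypeThornForks (realTuple L a) (realSet L (A ∪ B)) (realSet L A) ↔
      algDim L (A ∪ B) a = algDim L A a)

end

end

end ThornForking

open ThornForking

namespace ThornForking

section
variable {L : FirstOrder.Language.{v, w}} {C : Type u} [L.Structure C]

/-- Relations between real tuples that are definable in `C^eq` with parameters from `A`. -/
inductive DefOver (A : Set (Imag L C)) : ∀ {α : Type}, Set (α → C) → Prop
  | base {α : Type} {s : Set (α → C)} : (∅ : Set C).Definable L s → DefOver A s
  | param {e : Imag L C} : e ∈ A → DefOver A {v : Fin e.1.arity → C | e.1.cls v = e.2}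
  | inter {α : Type} {s t : Set (α → C)} : DefOver A s → DefOver A t → DefOver A (s ∩ t)
  | compl {α : Type} {s : Set (α → C)} : DefOver A s → DefOver A sᶜ
  | reindex {α β : Type} (f : α → β) {s : Set (α → C)} :
      DefOver A s → DefOver A {v : β → C | v ∘ f ∈ s}
  | proj {α β : Type} [Finite β] {s : Set (α ⊕ β → C)} :
      DefOver A s → DefOver A {v : α → C | ∃ w : β → C, Sum.elim v w ∈ s}

namespace DefOver

variable {A B : Set (Imag L C)} {α β : Type}

theorem mono (hAB : A ⊆ B) {s : Set (α → C)} (h : DefOver A s) : DefOver B s := by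
  induction h with
  | base h => exact .base h
  | param h => exact .param (hAB h)
  | inter _ _ h₁ h₂ => exact .inter h₁ h₂
  | compl _ h => exact .compl h
  | reindex f _ h => exact .reindex f h
  | proj _ h => exact .proj h

theorem and {P Q : (α → C) → Prop} (hP : DefOver A {v | P v}) (hQ : DefOver A {v | Q v}) :
    DefOver A {v | P v ∧ Q v} :=
  .inter hP hQ

theorem not {P : (α → C) → Prop} (hP : DefOver A {v | P v}) : DefOver A {v | ¬ P v} :=
  .compl hP

theorem congr {P Q : (α → C) → Prop} (hP : DefOver A {v | P v}) (h : ∀ v, Q v ↔ P v) :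
    DefOver A {v | Q v} := by
  rwa [show {v | Q v} = {v | P v} from Set.ext h]

theorem imp {P Q : (α → C) → Prop} (hP : DefOver A {v | P v}) (hQ : DefOver A {v | Q v}) :
    DefOver A {v | P v → Q v} :=
  (hP.and hQ.not).not.congr fun v => by simp

theorem exists' [Finite β] {P : (α → C) → (β → C) → Prop}
    (hP : DefOver A {v : α ⊕ β → C | P (v ∘ Sum.inl) (v ∘ Sum.inr)}) :
    DefOver A {v | ∃ w, P v w} :=
  hP.proj.congr fun _ => Iff.rfl

theorem const (p : Prop) : DefOver A {_v : α → C | p} := by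
  by_cases hp : p
  · simpa [hp] using (DefOver.base (A := A) (Set.definable_univ (L := L) (M := C) (α := α)))
  · simpa [hp] using (DefOver.base (A := A) (Set.definable_empty (L := L) (M := C) (α := α)))

theorem forall_finset {ι : Type*} (s : Finset ι) {P : ι → (α → C) → Prop}
    (hP : ∀ i ∈ s, DefOver A {v | P i v}) : DefOver A {v | ∀ i ∈ s, P i v} := by
  classical
  induction s using Finset.induction with
  | empty => exact (const True).congr (by simp)
  | insert i s _ ih =>
    exact ((hP i (by simp)).and (ih fun j hj => hP j (by simp [hj]))).congr (by simp)

theorem forall_finite {ι : Type*} [Finite ι] {P : ι → (α → C) → Prop}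
    (hP : ∀ i, DefOver A {v | P i v}) : DefOver A {v | ∀ i, P i v} := by
  cases nonempty_fintype ι
  exact (forall_finset Finset.univ fun i _ => hP i).congr (by simp)

theorem comp (f : α → β) {P : (α → C) → Prop} (hP : DefOver A {v | P v}) :
    DefOver A {v : β → C | P (v ∘ f)} :=
  .reindex f hP

theorem eq_var (i j : α) : DefOver A {v : α → C | v i = v j} := by
  refine .base (Set.empty_definable_iff.2 ⟨(Language.Term.var i).equal (Language.Term.var j), ?_⟩)
  ext v
  simp

/-- The tuples in the coordinates `f` and `g` have the same class. -/
theorem cls_eq (S : ImagSort L C) (f g : Fin S.arity → α) :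
    DefOver A {v : α → C | S.cls (v ∘ f) = S.cls (v ∘ g)} := by
  refine ((DefOver.base (A := A) S.definable).comp (Sum.elim f g)).congr fun v => ?_
  exact Quotient.eq

theorem cls_eq_param {e : Imag L C} (he : e ∈ A) (f : Fin e.1.arity → α) :
    DefOver A {v : α → C | e.1.cls (v ∘ f) = e.2} :=
  (DefOver.param he).comp f

end DefOver

theorem ImagSort.cls_surjective (S : ImagSort L C) : Function.Surjective S.cls :=
  Quotient.mk_surjective

theorem ImagSort.exists_cls_eq (S : ImagSort L C) (x : S.Elem) : ∃ v, S.cls v = x :=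
  S.cls_surjective x

/-- If every parameter from `A` is represented in the real set `R`, then relations definable over
`A` are definable over `R`. -/
theorem DefOver.definable {A : Set (Imag L C)} {R : Set C}
    (hR : ∀ e ∈ A, ∃ v : Fin e.1.arity → C, e.1.cls v = e.2 ∧ ∀ i, v i ∈ R)
    {α : Type} {s : Set (α → C)} (h : DefOver A s) : R.Definable L s := by
  induction h with
  | base h => exact h.mono (Set.empty_subset _)
  | @param e h =>
    obtain ⟨r, hr, hrR⟩ := hR e h
    have h1 : R.Definable L {v : Fin e.1.arity ⊕ Fin e.1.arity → C |
        e.1.rel (v ∘ Sum.inl) (v ∘ Sum.inr) ∧ ∀ i, v (Sum.inr i) = r i} := by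
      refine Set.Definable.inter (e.1.definable.mono (Set.empty_subset _))
        (g := {v : Fin e.1.arity ⊕ Fin e.1.arity → C | ∀ i, v (Sum.inr i) = r i}) ?_
      have : {v : Fin e.1.arity ⊕ Fin e.1.arity → C | ∀ i, v (Sum.inr i) = r i} =
          ⋂ i, {v | v (Sum.inr i) = r i} := by ext; simp
      rw [this]
      refine Set.definable_iInter_of_finite fun i => ?_
      exact (Set.Definable.singleton_of_mem L (hrR i)).preimage_comp (fun _ => Sum.inr i)
    convert h1.exists_of_finite using 1
    ext v
    rw [← hr]
    constructor
    · intro h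
      exact ⟨r, Quotient.exact h, fun _ => rfl⟩
    · rintro ⟨w, hw, hw'⟩
      have : w = r := funext hw'
      subst this
      exact Quotient.sound hw
  | inter _ _ h₁ h₂ => exact h₁.inter h₂
  | compl _ h => exact h.compl
  | reindex f _ h => exact h.preimage_comp f
  | proj _ h => exact h.exists_of_finite

theorem DefOver.empty_definable {α : Type} {s : Set (α → C)}
    (h : DefOver (∅ : Set (Imag L C)) s) : (∅ : Set C).Definable L s :=
  h.definable (by simp)

/-- A relation definable over `A` is given by a parameter-free relation and finitely many
parameters from `A`. -/
theorem DefOver.normalForm {A : Set (Imag L C)} {α : Type} {s : Set (α → C)} (h : DefOver A s) :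
    ∃ (ι : Type) (_ : Finite ι) (e : ι → Imag L C), (∀ i, e i ∈ A) ∧
      ∃ R : Set (α ⊕ (Σ i, Fin (e i).1.arity) → C), (∅ : Set C).Definable L R ∧
        ∀ y v, (∀ i, (e i).1.cls (fun j => v ⟨i, j⟩) = (e i).2) →
          (y ∈ s ↔ Sum.elim y v ∈ R) := by
  induction h with
  | @base α s h =>
    refine ⟨Empty, inferInstance, Empty.elim, by simp, {v | v ∘ Sum.inl ∈ s},
      h.preimage_comp Sum.inl, fun y v _ => by simp⟩
  | @param e h =>
    refine ⟨Unit, inferInstance, fun _ => e, by simp [h],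
      {v | e.1.cls (v ∘ Sum.inl) = e.1.cls (v ∘ (fun j => Sum.inr ⟨(), j⟩))},
      (DefOver.cls_eq e.1 _ _).empty_definable, fun y v hv => ?_⟩
    rw [Set.mem_ofPred_eq, ← hv ()]
    rfl
  | inter _ _ h₁ h₂ =>
    obtain ⟨ι₁, _, e₁, he₁, R₁, hR₁, h₁⟩ := h₁
    obtain ⟨ι₂, _, e₂, he₂, R₂, hR₂, h₂⟩ := h₂
    refine ⟨ι₁ ⊕ ι₂, inferInstance, Sum.elim e₁ e₂, by simp [he₁, he₂],
      {v | v ∘ (Sum.map id fun p : (Σ i, Fin (e₁ i).1.arity) =>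
          (⟨Sum.inl p.1, p.2⟩ : Σ i, Fin (Sum.elim e₁ e₂ i).1.arity)) ∈ R₁} ∩
        {v | v ∘ (Sum.map id fun p : (Σ i, Fin (e₂ i).1.arity) =>
          (⟨Sum.inr p.1, p.2⟩ : Σ i, Fin (Sum.elim e₁ e₂ i).1.arity)) ∈ R₂},
      (hR₁.preimage_comp _).inter (hR₂.preimage_comp _), fun y v hv => ?_⟩
    rw [Set.mem_inter_iff, h₁ y (fun p => v ⟨Sum.inl p.1, p.2⟩) fun i => hv (Sum.inl i),
      h₂ y (fun p => v ⟨Sum.inr p.1, p.2⟩) fun i => hv (Sum.inr i), Set.mem_inter_iff,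
      Set.mem_ofPred_eq, Set.mem_ofPred_eq, Sum.elim_comp_map, Sum.elim_comp_map]
    rfl
  | compl _ h =>
    obtain ⟨ι, _, e, he, R, hR, h⟩ := h
    exact ⟨ι, inferInstance, e, he, Rᶜ, hR.compl, fun y v hv => not_congr (h y v hv)⟩
  | reindex f _ h =>
    obtain ⟨ι, _, e, he, R, hR, h⟩ := h
    refine ⟨ι, inferInstance, e, he, {v | v ∘ Sum.map f id ∈ R}, hR.preimage_comp _,
      fun y v hv => ?_⟩
    rw [Set.mem_ofPred_eq, h _ v hv, Set.mem_ofPred_eq, Sum.elim_comp_map]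
    rfl
  | @proj α β _ s _ h =>
    obtain ⟨ι, _, e, he, R, hR, h⟩ := h
    refine ⟨ι, inferInstance, e, he, {v | ∃ w : β → C, Sum.elim v w ∘
        (Sum.elim (Sum.map Sum.inl id) (Sum.inl ∘ Sum.inr)) ∈ R},
      (hR.preimage_comp _).exists_of_finite, fun y v hv => ?_⟩
    refine exists_congr fun w => ?_
    rw [h _ v hv]
    refine iff_of_eq (congrArg (· ∈ R) (funext fun x => ?_))
    rcases x with (x | x) | x <;> rfl

theorem EqDefinable.defOver {A : Set (Imag L C)} {S : ImagSort L C} {X : Set S.Elem}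
    (h : EqDefinable A X) : DefOver A {w | S.cls w ∈ X} := by
  obtain ⟨m, e, he, φ, hφ, rfl⟩ := h
  have h1 : DefOver A {v : Fin S.arity ⊕ (Σ i, Fin (e i).1.arity) → C |
      (∀ i, (e i).1.cls (v ∘ fun j => Sum.inr ⟨i, j⟩) = (e i).2) ∧
        φ (S.cls fun j => v (Sum.inl j)) (fun i => (e i).1.cls fun j => v (Sum.inr ⟨i, j⟩))} :=
    (DefOver.forall_finite fun i => .cls_eq_param (he i) _).and (.base hφ)
  refine (DefOver.exists' (P := fun (w : Fin S.arity → C) (v : (Σ i, Fin (e i).1.arity) → C) =>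
    (∀ i, (e i).1.cls (fun j => v ⟨i, j⟩) = (e i).2) ∧
      φ (S.cls w) fun i => (e i).1.cls fun j => v ⟨i, j⟩) h1).congr fun w => ?_
  constructor
  · intro h
    choose r hr using fun i => (e i).1.exists_cls_eq (e i).2
    refine ⟨fun p => r p.1 p.2, hr, ?_⟩
    simpa only [hr, Set.mem_ofPred_eq] using h
  · rintro ⟨v, hv, h⟩
    simpa only [hv, Set.mem_ofPred_eq] using h

theorem DefOver.eqDefinable_image {A : Set (Imag L C)} {S : ImagSort L C}
    {Y : Set (Fin S.arity → C)} (h : DefOver A Y) : EqDefinable A (S.cls '' Y) := by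
  obtain ⟨ι, _, e, he, R, hR, h⟩ := h.normalForm
  obtain ⟨m, ⟨σ⟩⟩ := Finite.exists_equiv_fin ι
  obtain ⟨e', rfl⟩ : ∃ e' : Fin m → Imag L C, e = e' ∘ σ := ⟨e ∘ σ.symm, by ext1; simp⟩
  let τ : (Σ i, Fin ((e' ∘ σ) i).1.arity) → (Σ k, Fin (e' k).1.arity) := fun p => ⟨σ p.1, p.2⟩
  refine ⟨m, e', fun k => by simpa using he (σ.symm k), fun x f => ∃ w, S.cls w = x ∧
    ∃ v : (Σ k, Fin (e' k).1.arity) → C, (∀ k, (e' k).1.cls (fun j => v ⟨k, j⟩) = f k) ∧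
      Sum.elim w (v ∘ τ) ∈ R, ?_, ?_⟩
  · refine DefOver.empty_definable ?_
    refine DefOver.exists' (P := fun (v : Fin S.arity ⊕ (Σ i, Fin (e' i).1.arity) → C)
      (w : Fin S.arity → C) => S.cls w = S.cls (fun j => v (Sum.inl j)) ∧
        ∃ v' : (Σ k, Fin (e' k).1.arity) → C, (∀ k, (e' k).1.cls (fun j => v' ⟨k, j⟩) =
          (e' k).1.cls (fun j => v (Sum.inr ⟨k, j⟩))) ∧ Sum.elim w (v' ∘ τ) ∈ R) ?_
    refine (DefOver.cls_eq S _ _).and ?_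
    refine DefOver.exists' (P := fun (u : (Fin S.arity ⊕ (Σ i, Fin (e' i).1.arity)) ⊕ Fin S.arity → C)
      (v' : (Σ k, Fin (e' k).1.arity) → C) => (∀ k, (e' k).1.cls (fun j => v' ⟨k, j⟩) =
          (e' k).1.cls (fun j => u (Sum.inl (Sum.inr ⟨k, j⟩)))) ∧
            Sum.elim (u ∘ Sum.inr) (v' ∘ τ) ∈ R) ?_
    refine (DefOver.forall_finite fun k => DefOver.cls_eq _ _ _).and ?_
    refine ((DefOver.base hR).comp (Sum.elim (Sum.inl ∘ Sum.inr) (Sum.inr ∘ τ))).congr fun v => ?_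
    rw [Sum.comp_elim]
    rfl
  · have key : ∀ w (v : (Σ k, Fin (e' k).1.arity) → C),
        (∀ k, (e' k).1.cls (fun j => v ⟨k, j⟩) = (e' k).2) → (w ∈ Y ↔ Sum.elim w (v ∘ τ) ∈ R) :=
      fun w v hv => h w (v ∘ τ) fun i => hv (σ i)
    choose r hr using fun k => (e' k).1.exists_cls_eq (e' k).2
    ext x
    constructor
    · rintro ⟨w, hw, rfl⟩
      exact ⟨w, rfl, fun p => r p.1 p.2, hr, (key w (fun p => r p.1 p.2) hr).1 hw⟩
    · rintro ⟨w, rfl, v, hv, hR⟩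
      exact ⟨w, (key w v hv).2 hR, rfl⟩

theorem eqDefinable_iff {A : Set (Imag L C)} {S : ImagSort L C} {X : Set S.Elem} :
    EqDefinable A X ↔ DefOver A {w | S.cls w ∈ X} := by
  refine ⟨EqDefinable.defOver, fun h => ?_⟩
  have := h.eqDefinable_image
  rwa [show S.cls '' {w | S.cls w ∈ X} = X from
    Set.image_preimage_eq X S.cls_surjective] at this

end

section
variable {L : FirstOrder.Language.{v, w}} {C : Type u} [L.Structure C]

theorem encard_le_of_forall_not_injective {X : Type*} {s : Set X} {k : ℕ}
    (h : ∀ f : Fin k → X, Function.Injective f → ¬ ∀ i, f i ∈ s) : s.encard ≤ k := by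
  by_contra! hk
  obtain ⟨t, hts, ht⟩ := Set.exists_subset_encard_eq hk.le
  have hfin : t.Finite := Set.finite_of_encard_eq_coe ht
  have hcard : Nat.card t = k := by
    have := hfin.cast_ncard_eq
    rw [ht] at this
    exact_mod_cast this
  have : Finite t := hfin
  let σ := Finite.equivFinOfCardEq hcard
  exact h (fun i => (σ.symm i : X)) (Subtype.val_injective.comp σ.symm.injective)
    fun i => hts (σ.symm i).2

theorem not_injective_of_encard_lt {X : Type*} {s : Set X} {k : ℕ} (h : s.encard < k)
    (f : Fin k → X) (hf : Function.Injective f) : ¬ ∀ i, f i ∈ s := by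
  intro hfs
  have h1 : (Set.range f).encard = k := by
    rw [← Set.image_univ, hf.encard_image]
    simp
  exact absurd (Set.encard_le_encard (Set.range_subset_iff.2 hfs)) (by rw [h1]; exact not_le.2 h)

/-- The classes of a family of tuples of variables. -/
abbrev clsFamily {τ : Type} (f : τ → Imag L C) (z : (Σ t, Fin (f t).1.arity) → C) :
    ∀ t, (f t).1.Elem :=
  fun t => (f t).1.cls fun j => z ⟨t, j⟩

theorem exists_clsFamily_eq {τ : Type} (f : τ → Imag L C) (x : ∀ t, (f t).1.Elem) :
    ∃ z, clsFamily f z = x := by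
  choose r hr using fun t => (f t).1.exists_cls_eq (x t)
  exact ⟨fun p => r p.1 p.2, funext hr⟩

/-- Parameters `f` can be separated from the parameters in `A`. -/
theorem DefOver.separate {A : Set (Imag L C)} {τ : Type} (f : τ → Imag L C) {α : Type}
    {s : Set (α → C)} (h : DefOver (A ∪ Set.range f) s) :
    ∃ Z : (α → C) → (∀ t, (f t).1.Elem) → Prop,
      DefOver A {v : α ⊕ (Σ t, Fin (f t).1.arity) → C |
        Z (v ∘ Sum.inl) (clsFamily f (v ∘ Sum.inr))} ∧
      ∀ y, y ∈ s ↔ Z y fun t => (f t).2 := by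
  generalize hB : A ∪ Set.range f = B at h
  induction h with
  | @base α s h => exact ⟨fun y _ => y ∈ s, (DefOver.base h).comp _, fun y => Iff.rfl⟩
  | @param e h =>
    subst hB
    rcases h with h | ⟨t, rfl⟩
    · exact ⟨fun y _ => e.1.cls y = e.2, (DefOver.param h).comp _, fun y => Iff.rfl⟩
    · exact ⟨fun y x => (f t).1.cls y = x t, DefOver.cls_eq _ _ _, fun y => Iff.rfl⟩
  | inter _ _ h₁ h₂ =>
    obtain ⟨Z₁, hZ₁, h₁⟩ := h₁
    obtain ⟨Z₂, hZ₂, h₂⟩ := h₂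
    exact ⟨fun y x => Z₁ y x ∧ Z₂ y x, hZ₁.and hZ₂, fun y => and_congr (h₁ y) (h₂ y)⟩
  | compl _ h =>
    obtain ⟨Z, hZ, h⟩ := h
    exact ⟨fun y x => ¬ Z y x, hZ.not, fun y => not_congr (h y)⟩
  | reindex g _ h =>
    obtain ⟨Z, hZ, h⟩ := h
    exact ⟨fun y x => Z (y ∘ g) x, hZ.comp (Sum.map g id), fun y => h (y ∘ g)⟩
  | @proj α β _ s _ h =>
    obtain ⟨Z, hZ, h⟩ := h
    refine ⟨fun y x => ∃ w, Z (Sum.elim y w) x, ?_, fun y => exists_congr fun w => h _⟩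
    refine DefOver.exists' (P := fun (v : α ⊕ (Σ t, Fin (f t).1.arity) → C) (w : β → C) =>
      Z (Sum.elim (v ∘ Sum.inl) w) (clsFamily f (v ∘ Sum.inr))) ?_
    refine (hZ.comp (Sum.elim (Sum.map Sum.inl id) (Sum.inl ∘ Sum.inr))).congr fun v => ?_
    refine iff_of_eq (congrArg₂ Z (funext fun x => ?_) rfl)
    rcases x with x | x <;> rfl

/-- Membership in the algebraic closure of `D` and finitely many further imaginaries is witnessed
by a relation over `D` whose fibres are uniformly finite. -/
theorem mem_aclEq_union_range_iff {D : Set (Imag L C)} {τ : Type} [Finite τ] (f : τ → Imag L C)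
    (e : Imag L C) :
    e ∈ aclEq (D ∪ Set.range f) ↔
      ∃ (N : ℕ) (W : e.1.Elem → (∀ t, (f t).1.Elem) → Prop),
        DefOver D {v : Fin e.1.arity ⊕ (Σ t, Fin (f t).1.arity) → C |
          W (e.1.cls (v ∘ Sum.inl)) (clsFamily f (v ∘ Sum.inr))} ∧
        (∀ x, {y | W y x}.encard ≤ N) ∧ W e.2 fun t => (f t).2 := by
  constructor
  · rintro ⟨X, hX, hfin, he⟩
    obtain ⟨Z, hZ, hZX⟩ := hX.defOver.separate f
    set N := X.ncard + 1 with hN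
    let W₀ : e.1.Elem → (∀ t, (f t).1.Elem) → Prop := fun y x => ∃ w, e.1.cls w = y ∧ Z w x
    have hW₀ : ∀ y, W₀ y (fun t => (f t).2) ↔ y ∈ X := by
      intro y
      constructor
      · rintro ⟨w, rfl, hw⟩
        exact (hZX w).2 hw
      · intro hy
        obtain ⟨w, rfl⟩ := e.1.exists_cls_eq y
        exact ⟨w, rfl, (hZX w).1 hy⟩
    have hW₀def : DefOver D {v : Fin e.1.arity ⊕ (Σ t, Fin (f t).1.arity) → C |
          W₀ (e.1.cls (v ∘ Sum.inl)) (clsFamily f (v ∘ Sum.inr))} := by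
      refine DefOver.exists' (P := fun (v : Fin e.1.arity ⊕ (Σ t, Fin (f t).1.arity) → C)
        (w : Fin e.1.arity → C) => e.1.cls w = e.1.cls (v ∘ Sum.inl) ∧
          Z w (clsFamily f (v ∘ Sum.inr))) ?_
      exact (DefOver.cls_eq _ _ _).and (hZ.comp (Sum.elim Sum.inr (Sum.inl ∘ Sum.inr)))
    let W : e.1.Elem → (∀ t, (f t).1.Elem) → Prop := fun y x => W₀ y x ∧
      ¬ ∃ g : Fin N → e.1.Elem, (∀ i j, g i = g j → i = j) ∧ ∀ i, W₀ (g i) x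
    refine ⟨N, W, hW₀def.and (DefOver.not ?_), fun x => ?_, (hW₀ _).2 he, ?_⟩
    · have h1 : ∀ x, (∃ g : Fin N → e.1.Elem, (∀ i j, g i = g j → i = j) ∧ ∀ i, W₀ (g i) x) ↔
          ∃ g : Fin N × Fin e.1.arity → C, (∀ i j, e.1.cls (fun k => g (i, k)) =
            e.1.cls (fun k => g (j, k)) → i = j) ∧ ∀ i, W₀ (e.1.cls fun k => g (i, k)) x := by
        intro x
        constructor
        · rintro ⟨g, hg⟩
          choose r hr using fun i => e.1.exists_cls_eq (g i)
          exact ⟨fun p => r p.1 p.2, by simpa only [hr] using hg⟩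
        · rintro ⟨g, hg⟩
          exact ⟨fun i => e.1.cls fun k => g (i, k), hg⟩
      refine DefOver.congr (P := fun v => _) ?_ fun v => h1 _
      refine DefOver.exists' (P := fun (v : Fin e.1.arity ⊕ (Σ t, Fin (f t).1.arity) → C)
        (g : Fin N × Fin e.1.arity → C) => (∀ i j, e.1.cls (fun k => g (i, k)) =
            e.1.cls (fun k => g (j, k)) → i = j) ∧
              ∀ i, W₀ (e.1.cls fun k => g (i, k)) (clsFamily f (v ∘ Sum.inr))) ?_
      refine (DefOver.forall_finite fun i => DefOver.forall_finite fun j =>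
        (DefOver.cls_eq e.1 (fun k => Sum.inr (i, k)) fun k => Sum.inr (j, k)).imp
          (DefOver.const (i = j))).and (DefOver.forall_finite fun i => ?_)
      exact hW₀def.comp (Sum.elim (fun k => Sum.inr (i, k)) (Sum.inl ∘ Sum.inr))
    · by_cases hx : ∃ g : Fin N → e.1.Elem, (∀ i j, g i = g j → i = j) ∧ ∀ i, W₀ (g i) x
      · have : {y | W y x} = ∅ := Set.eq_empty_of_forall_notMem fun y hy => hy.2 hx
        simp [this]
      · refine encard_le_of_forall_not_injective fun g hg hgW => hx ⟨g, hg, fun i => (hgW i).1⟩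
    · rintro ⟨g, hg, hgX⟩
      refine not_injective_of_encard_lt (s := X) (k := N) ?_ g hg fun i => (hW₀ _).1 (hgX i)
      rw [← hfin.cast_ncard_eq, hN]
      exact_mod_cast Nat.lt_succ_self _
  · rintro ⟨N, W, hW, hN, he⟩
    refine ⟨{y | W y fun t => (f t).2}, eqDefinable_iff.2 ?_,
      Set.finite_of_encard_le_coe (hN _), he⟩
    have h1 : DefOver (D ∪ Set.range f) {w : Fin e.1.arity → C | ∃ z : (Σ t, Fin (f t).1.arity) → C,
        (∀ t, (f t).1.cls (fun j => z ⟨t, j⟩) = (f t).2) ∧ W (e.1.cls w) (clsFamily f z)} := by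
      refine DefOver.exists' (P := fun (w : Fin e.1.arity → C)
        (z : (Σ t, Fin (f t).1.arity) → C) =>
        (∀ t, (f t).1.cls (fun j => z ⟨t, j⟩) = (f t).2) ∧ W (e.1.cls w) (clsFamily f z)) ?_
      exact (DefOver.forall_finite fun t => DefOver.cls_eq_param (Or.inr ⟨t, rfl⟩) _).and
        (hW.mono Set.subset_union_left)
    refine h1.congr fun w => ?_
    constructor
    · intro h
      obtain ⟨z, hz⟩ := exists_clsFamily_eq f fun t => (f t).2
      exact ⟨z, fun t => congrFun hz t, by rw [hz]; exact h⟩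
    · rintro ⟨z, hz, h⟩
      rwa [show clsFamily f z = fun t => (f t).2 from funext hz] at h

theorem EqDefinable.mono {A B : Set (Imag L C)} (hAB : A ⊆ B) {S : ImagSort L C} {X : Set S.Elem}
    (h : EqDefinable A X) : EqDefinable B X :=
  eqDefinable_iff.2 (h.defOver.mono hAB)

theorem aclEq_mono {A B : Set (Imag L C)} (hAB : A ⊆ B) : aclEq A ⊆ aclEq B :=
  fun _ ⟨X, hX, h⟩ => ⟨X, hX.mono hAB, h⟩

theorem subset_aclEq (A : Set (Imag L C)) : A ⊆ aclEq A :=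
  fun e he => ⟨{e.2}, eqDefinable_iff.2 (.param he), Set.finite_singleton _, rfl⟩

theorem exists_finite_of_mem_aclEq {A : Set (Imag L C)} {e : Imag L C} (he : e ∈ aclEq A) :
    ∃ (m : ℕ) (f : Fin m → Imag L C), (∀ i, f i ∈ A) ∧ e ∈ aclEq (Set.range f) := by
  obtain ⟨X, ⟨m, f, hf, φ, hφ⟩, hX⟩ := he
  exact ⟨m, f, hf, X, ⟨m, f, fun i => ⟨i, rfl⟩, φ, hφ⟩, hX⟩

theorem aclEq_subset_of_subset {A B : Set (Imag L C)} (hBA : B ⊆ aclEq A) :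
    aclEq B ⊆ aclEq A := by
  intro e he
  obtain ⟨m, f, hf, he⟩ := exists_finite_of_mem_aclEq he
  rw [← Set.empty_union (Set.range f), mem_aclEq_union_range_iff] at he
  obtain ⟨N, W, hW, hN, he⟩ := he
  choose F hF hFfin hfF using fun i => hBA (hf i)
  refine ⟨{y | ∃ x, (∀ t, x t ∈ F t) ∧ W y x}, eqDefinable_iff.2 ?_, ?_, _, hfF, he⟩
  · have h1 : DefOver A {w : Fin e.1.arity → C | ∃ z : (Σ t, Fin (f t).1.arity) → C,
        (∀ t, (f t).1.cls (fun j => z ⟨t, j⟩) ∈ F t) ∧ W (e.1.cls w) (clsFamily f z)} := by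
      refine DefOver.exists' (P := fun (w : Fin e.1.arity → C)
        (z : (Σ t, Fin (f t).1.arity) → C) =>
        (∀ t, (f t).1.cls (fun j => z ⟨t, j⟩) ∈ F t) ∧ W (e.1.cls w) (clsFamily f z)) ?_
      exact (DefOver.forall_finite fun t => (hF t).defOver.comp fun j => Sum.inr ⟨t, j⟩).and
        (hW.mono (Set.empty_subset _))
    refine h1.congr fun w => ?_
    constructor
    · rintro ⟨x, hx, h⟩
      obtain ⟨z, rfl⟩ := exists_clsFamily_eq f x
      exact ⟨z, hx, h⟩
    · rintro ⟨z, hz, h⟩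
      exact ⟨_, hz, h⟩
  · have : {y | ∃ x, (∀ t, x t ∈ F t) ∧ W y x} ⊆ ⋃ x ∈ Set.univ.pi F, {y | W y x} := by
      rintro y ⟨x, hx, h⟩
      exact Set.mem_biUnion (fun t _ => hx t) h
    refine Set.Finite.subset (Set.Finite.biUnion (Set.Finite.pi' hFfin |>.subset ?_) fun x _ =>
      Set.finite_of_encard_le_coe (hN x)) this
    intro x hx t
    exact hx t trivial

theorem aclEq_idem (A : Set (Imag L C)) : aclEq (aclEq A) = aclEq A :=
  (aclEq_subset_of_subset subset_rfl).antisymm (subset_aclEq _)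

/-! ### Real elements -/

variable (L) in
/-- A real element as an element of `C^eq`. -/
abbrev realPt (a : C) : Imag L C := ⟨realSort L C 1, realTuple L fun _ => a⟩

variable (L) in
/-- A real tuple as an element of `C^eq`. -/
abbrev tuplePt {n : ℕ} (a : Fin n → C) : Imag L C := ⟨realSort L C n, realTuple L a⟩

theorem realTuple_injective (n : ℕ) :
    Function.Injective (realTuple L : (Fin n → C) → (realSort L C n).Elem) :=
  fun _ _ h => Quotient.exact h

theorem realTuple_surjective (n : ℕ) :
    Function.Surjective (realTuple L : (Fin n → C) → (realSort L C n).Elem) :=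
  (realSort L C n).cls_surjective

theorem realPt_injective : Function.Injective (realPt L : C → Imag L C) := by
  intro a b h
  have := realTuple_injective 1 (eq_of_heq (Sigma.mk.inj h).2)
  exact congrFun this 0

theorem realPt_mem_realSet {a : C} {A : Set C} : realPt L a ∈ realSet L A ↔ a ∈ A :=
  realPt_injective.mem_set_image

theorem realSet_mono {A B : Set C} (h : A ⊆ B) : realSet L A ⊆ realSet L B :=
  Set.image_mono h

theorem realSet_union (A B : Set C) : realSet L (A ∪ B) = realSet L A ∪ realSet L B :=
  Set.image_union _ _ _

theorem realSet_insert (a : C) (A : Set C) :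
    realSet L (insert a A) = insert (realPt L a) (realSet L A) :=
  Set.image_insert_eq

theorem realSet_empty : realSet L (∅ : Set C) = ∅ :=
  Set.image_empty _

theorem DefOver.eq_const {A : Set (Imag L C)} {α : Type} {a : C} (ha : realPt L a ∈ A) (i : α) :
    DefOver A {v : α → C | v i = a} := by
  refine (DefOver.cls_eq_param ha fun _ => i).congr fun v => ?_
  refine ⟨?_, fun h => congrFun (realTuple_injective 1 h) 0⟩
  rintro rfl
  rfl

theorem DefOver.of_definable {A : Set C} {α : Type} {s : Set (α → C)} (h : A.Definable L s) :
    DefOver (realSet L A) s := by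
  obtain ⟨A₀, hA₀, h⟩ := Set.definable_iff_finitely_definable.1 h
  obtain ⟨φ, rfl⟩ := Set.definable_iff_exists_formula_sum.1 h
  let σ := A₀.equivFin
  have h1 : DefOver (realSet L A) {v : α → C | ∃ z : Fin A₀.card → C,
      (∀ i, z i = σ.symm i) ∧ (φ.relabel (Sum.elim (Sum.inr ∘ σ) Sum.inl)).Realize (Sum.elim v z)} := by
    refine DefOver.exists' (P := fun (v : α → C) (z : Fin A₀.card → C) => (∀ i, z i = σ.symm i) ∧
      (φ.relabel (Sum.elim (Sum.inr ∘ σ) Sum.inl)).Realize (Sum.elim v z)) ?_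
    refine (DefOver.forall_finite fun i => DefOver.eq_const
      (realPt_mem_realSet.2 (hA₀ (σ.symm i).2)) _).and (.base ?_)
    refine Set.empty_definable_iff.2 ⟨φ.relabel (Sum.elim (Sum.inr ∘ σ) Sum.inl), ?_⟩
    ext v
    rw [Set.mem_ofPred_eq, Sum.elim_comp_inl_inr]
    rfl
  refine h1.congr fun v => ?_
  simp only [Language.Formula.realize_relabel]
  constructor
  · intro h
    refine ⟨fun i => σ.symm i, fun i => rfl, ?_⟩
    convert! h using 1
    ext x
    rcases x with x | x <;> simp
  · rintro ⟨z, hz, h⟩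
    convert! h using 1
    ext x
    rcases x with x | x <;> simp [hz]

theorem realPt_mem_aclEq_realSet {A : Set C} {b : C} :
    realPt L b ∈ aclEq (realSet L A) ↔ b ∈ acl L A := by
  constructor
  · rintro ⟨X, hX, hfin, hb⟩
    refine ⟨{a | realTuple L (fun _ => a) ∈ X}, ?_, hfin.preimage ?_, hb⟩
    · have := hX.defOver.definable (R := A) (by
        rintro _ ⟨a, ha, rfl⟩
        exact ⟨fun _ => a, rfl, fun _ => ha⟩)
      unfold Set.Definable₁
      convert! this using 1
      ext v
      have : v = fun _ => v 0 := by
        ext i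
        rw [Subsingleton.elim i 0]
      rw [Set.mem_ofPred_eq, Set.mem_ofPred_eq]
      conv_rhs => rw [this]
      rfl
    · exact fun a _ b _ h => congrFun (realTuple_injective 1 h) 0
  · rintro ⟨X, hX, hfin, hb⟩
    refine ⟨_, (DefOver.of_definable hX).eqDefinable_image (S := realSort L C 1),
      Set.Finite.image _ ?_, _, hb, rfl⟩
    refine Set.Finite.subset (hfin.image fun a _ => a) ?_
    intro v hv
    refine ⟨v 0, hv, ?_⟩
    ext i
    rw [Subsingleton.elim i 0]

theorem tuplePt_mem_aclEq {n : ℕ} {a : Fin n → C} {A : Set (Imag L C)}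
    (h : ∀ i, realPt L (a i) ∈ A) : tuplePt L a ∈ aclEq A := by
  refine ⟨{realTuple L a}, eqDefinable_iff.2 ?_, Set.finite_singleton _, rfl⟩
  refine (DefOver.forall_finite fun i => DefOver.eq_const (h i) i).congr fun v => ?_
  rw [← funext_iff]
  exact ⟨fun h => realTuple_injective n h, fun h => congrArg _ h⟩

theorem realPt_mem_aclEq_tuplePt {n : ℕ} (a : Fin n → C) (i : Fin n) :
    realPt L (a i) ∈ aclEq {tuplePt L a} := by
  refine ⟨{realTuple L fun _ => a i}, eqDefinable_iff.2 ?_, Set.finite_singleton _, rfl⟩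
  have h1 : DefOver {tuplePt L a} {v : Fin 1 → C | ∃ z : Fin n → C,
      (realSort L C n).cls z = realTuple L a ∧ v 0 = z i} := by
    refine DefOver.exists' (P := fun (v : Fin 1 → C) (z : Fin n → C) =>
      (realSort L C n).cls z = realTuple L a ∧ v 0 = z i) ?_
    exact (DefOver.cls_eq_param (e := tuplePt L a) (Set.mem_singleton _) Sum.inr).and (DefOver.eq_var _ _)
  refine h1.congr fun v => ?_
  constructor
  · intro h
    exact ⟨a, rfl, congrFun (realTuple_injective 1 h) 0⟩
  · rintro ⟨z, hz, h⟩
    rw [realTuple_injective n hz] at h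
    refine congrArg (realTuple L) (funext fun j => ?_)
    rw [Subsingleton.elim j 0, h]

end

section
variable {L : FirstOrder.Language.{v, w}} {C : Type u} [L.Structure C]

/-! ### Saturation for finite tuples and imaginary parameters -/

theorem definable_elim {A : Set C} {α β : Type} [Finite α] {s : Set (α ⊕ β → C)}
    (hs : A.Definable L s) {c : α → C} (hc : ∀ i, c i ∈ A) :
    A.Definable L {v : β → C | Sum.elim c v ∈ s} := by
  have h1 : A.Definable L ({u : β ⊕ α → C | u ∘ Sum.swap ∈ s} ∩ ⋂ i, {u | u (Sum.inr i) = c i}) :=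
    (hs.preimage_comp _).inter (Set.definable_iInter_of_finite fun i =>
      (Set.Definable.singleton_of_mem L (hc i)).preimage_comp fun _ => Sum.inr i)
  convert! h1.exists_of_finite using 1
  ext v
  simp only [Set.mem_ofPred_eq, Set.mem_inter_iff, Set.mem_iInter, Sum.elim_inr, ← funext_iff]
  have h2 : ∀ u : α → C, Sum.elim v u ∘ Sum.swap = Sum.elim u v := by
    intro u
    ext x
    rcases x with x | x <;> rfl
  simp only [h2]
  exact ⟨fun h => ⟨c, h, rfl⟩, fun ⟨u, h, hu⟩ => hu ▸ h⟩

variable {κ : Cardinal.{u}}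

theorem IsMonster.exists_forall_mem₁ (hC : IsMonster L C κ) {A : Set C} (hA : #A < κ)
    {ι : Type*} (F : ι → Set C) (hF : ∀ i, A.Definable₁ L (F i))
    (hfip : ∀ s : Finset ι, ∃ x, ∀ i ∈ s, x ∈ F i) : ∃ x, ∀ i, x ∈ F i := by
  classical
  choose φ hφ using hF
  have hφ' : ∀ i x, ((φ i).relabel fun _ => ()).Realize (fun _ : Unit => x) ↔ x ∈ F i := by
    intro i x
    rw [Language.Formula.realize_relabel]
    have := Set.ext_iff.1 (hφ i) fun _ => x
    exact this.symm
  obtain ⟨x, hx⟩ := hC.saturated A hA (Set.range fun i => (φ i).relabel fun _ => ()) (by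
    intro q hq
    choose j hj using fun ψ : q => hq ψ.2
    obtain ⟨x, hx⟩ := hfip (Finset.univ.image j)
    refine ⟨x, fun ψ hψ => ?_⟩
    rw [← show _ = ψ from hj ⟨ψ, hψ⟩]
    exact (hφ' _ _).2 (hx _ (Finset.mem_image_of_mem _ (Finset.mem_univ _))))
  exact ⟨x, fun i => (hφ' i x).1 (hx _ ⟨i, rfl⟩)⟩

theorem mk_union_lt {X : Type u} (hκ : ℵ₀ < κ) {A B : Set X} (hA : #A < κ) (hB : #B < κ) :
    #(A ∪ B : Set X) < κ :=
  (mk_union_le A B).trans_lt (add_lt_of_lt hκ.le hA hB)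

theorem mk_lt_of_finite {X : Type u} (hκ : ℵ₀ < κ) {A : Set X} (hA : A.Finite) : #A < κ :=
  (lt_aleph0_iff_set_finite.2 hA).trans hκ

theorem mk_insert_lt {X : Type u} (hκ : ℵ₀ < κ) {A : Set X} (hA : #A < κ) (x : X) :
    #(insert x A : Set X) < κ :=
  mk_union_lt hκ (mk_lt_of_finite hκ (Set.finite_singleton x)) hA

theorem IsMonster.exists_forall_mem_fin (hC : IsMonster L C κ) (n : ℕ) {ι : Type*} :
    ∀ {A : Set C}, #A < κ → ∀ F : ι → Set (Fin n → C), (∀ i, A.Definable L (F i)) →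
      (∀ s : Finset ι, ∃ v, ∀ i ∈ s, v ∈ F i) → ∃ v, ∀ i, v ∈ F i := by
  classical
  induction n generalizing ι with
  | zero =>
    intro A _ F _ hfip
    refine ⟨Fin.elim0, fun i => ?_⟩
    obtain ⟨v, hv⟩ := hfip {i}
    rw [Subsingleton.elim Fin.elim0 v]
    exact hv i (by simp)
  | succ n ih =>
    intro A hA F hF hfip
    let g : Fin (n + 1) → Fin n ⊕ Fin 1 := finSumFinEquiv.symm
    have hdef : ∀ s : Finset ι, A.Definable L {u : Fin n ⊕ Fin 1 → C | ∀ i ∈ s, u ∘ g ∈ F i} := by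
      intro s
      have := Set.definable_biInter_finset (L := L) (A := A)
        (f := fun i => {u : Fin n ⊕ Fin 1 → C | u ∘ g ∈ F i}) (fun i => (hF i).preimage_comp g) s
      convert! this using 1
      ext u
      simp
    obtain ⟨v, hv⟩ := ih (ι := Finset ι) hA
      (fun s => {v | ∃ w : Fin 1 → C, Sum.elim v w ∈ {u | ∀ i ∈ s, u ∘ g ∈ F i}})
      (fun s => (hdef s).exists_of_finite) (by
        intro S
        obtain ⟨u, hu⟩ := hfip (S.biUnion id)
        refine ⟨u ∘ finSumFinEquiv ∘ Sum.inl, fun s hs =>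
          ⟨u ∘ finSumFinEquiv ∘ Sum.inr, fun i hi => ?_⟩⟩
        have : Sum.elim (u ∘ finSumFinEquiv ∘ Sum.inl) (u ∘ finSumFinEquiv ∘ Sum.inr) ∘ g = u := by
          rw [← Function.comp_assoc, ← Function.comp_assoc, Sum.elim_comp_inl_inr]
          ext x
          simp [g]
        rw [this]
        exact hu i (Finset.mem_biUnion.2 ⟨s, hs, hi⟩))
    obtain ⟨x, hx⟩ := hC.exists_forall_mem₁ (A := A ∪ Set.range v)
      (mk_union_lt hC.aleph0_lt hA (mk_lt_of_finite hC.aleph0_lt (Set.finite_range v)))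
      (fun i => {x | Sum.elim v (fun _ : Fin 1 => x) ∘ g ∈ F i}) (by
        intro i
        have := definable_elim (((hF i).mono Set.subset_union_left).preimage_comp g)
          (c := v) (A := A ∪ Set.range v) fun j => Or.inr ⟨j, rfl⟩
        unfold Set.Definable₁
        convert! this using 1
        ext w
        have hw : w = fun _ => w 0 := by
          ext j
          rw [Subsingleton.elim j 0]
        rw [Set.mem_ofPred_eq, Set.mem_ofPred_eq, ← hw]
        rfl) (by
        intro s
        obtain ⟨w, hw⟩ := hv s
        refine ⟨w 0, fun i hi => ?_⟩
        have hw' : (fun _ => w 0) = w := by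
          ext j
          rw [Subsingleton.elim j 0]
        rw [Set.mem_ofPred_eq, hw']
        exact hw i hi)
    exact ⟨_, hx⟩

theorem IsMonster.exists_forall_mem_definable (hC : IsMonster L C κ) {α : Type} [Finite α]
    {ι : Type*} {A : Set C} (hA : #A < κ) (F : ι → Set (α → C)) (hF : ∀ i, A.Definable L (F i))
    (hfip : ∀ s : Finset ι, ∃ v, ∀ i ∈ s, v ∈ F i) : ∃ v, ∀ i, v ∈ F i := by
  obtain ⟨n, ⟨σ⟩⟩ := Finite.exists_equiv_fin α
  obtain ⟨v, hv⟩ := hC.exists_forall_mem_fin n hA (fun i => {v : Fin n → C | v ∘ σ ∈ F i})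
    (fun i => (hF i).preimage_comp σ) (by
      intro s
      obtain ⟨v, hv⟩ := hfip s
      refine ⟨v ∘ σ.symm, fun i hi => ?_⟩
      rw [Set.mem_ofPred_eq, Function.comp_assoc, σ.symm_comp_self]
      exact hv i hi)
  exact ⟨_, hv⟩

theorem exists_small_representatives (hκ : ℵ₀ < κ) {A : Set (Imag L C)} (hA : #A < κ) :
    ∃ R : Set C, #R < κ ∧ ∀ e ∈ A, ∃ v : Fin e.1.arity → C, e.1.cls v = e.2 ∧ ∀ i, v i ∈ R := by
  choose r hr using fun e : Imag L C => e.1.exists_cls_eq e.2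
  refine ⟨⋃ e : A, Set.range (r e), ?_, fun e he => ⟨r e, hr e, fun i =>
    Set.mem_iUnion.2 ⟨⟨e, he⟩, i, rfl⟩⟩⟩
  refine (mk_iUnion_le_sum_mk.trans ?_).trans_lt (mul_lt_of_lt hκ.le hA hκ)
  refine (sum_le_sum _ (fun _ => ℵ₀) fun e => ?_).trans ?_
  · exact (lt_aleph0_iff_set_finite.2 (Set.finite_range _)).le
  · simp

/-- Families of relations definable over a small set of imaginaries satisfy compactness. -/
theorem IsMonster.exists_forall_mem (hC : IsMonster L C κ) {α : Type} [Finite α] {ι : Type*}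
    {A : Set (Imag L C)} (hA : #A < κ) (F : ι → Set (α → C)) (hF : ∀ i, DefOver A (F i))
    (hfip : ∀ s : Finset ι, ∃ v, ∀ i ∈ s, v ∈ F i) : ∃ v, ∀ i, v ∈ F i := by
  obtain ⟨R, hR, hAR⟩ := exists_small_representatives hC.aleph0_lt hA
  exact hC.exists_forall_mem_definable hR F (fun i => (hF i).definable hAR) hfip

end

section
variable {L : FirstOrder.Language.{v, w}} {C : Type u} [L.Structure C]

/-! ### Real algebraic closure in the monster model and its elementary submodels -/

theorem acl_mono {N : Type u} [L.Structure N] {A B : Set N} (h : A ⊆ B) : acl L A ⊆ acl L B :=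
  fun _ ⟨X, hX, hb⟩ => ⟨X, hX.mono h, hb⟩

theorem subset_acl (A : Set C) : A ⊆ acl L A :=
  fun _ ha => realPt_mem_aclEq_realSet.1 (subset_aclEq _ (realPt_mem_realSet.2 ha))

theorem acl_subset_of_subset {A B : Set C} (h : B ⊆ acl L A) : acl L B ⊆ acl L A := by
  intro b hb
  refine realPt_mem_aclEq_realSet.1 (aclEq_subset_of_subset ?_ (realPt_mem_aclEq_realSet.2 hb))
  rintro _ ⟨a, ha, rfl⟩
  exact realPt_mem_aclEq_realSet.2 (h ha)

theorem exists_finite_of_mem_acl {A : Set C} {b : C} (h : b ∈ acl L A) :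
    ∃ S : Finset C, (S : Set C) ⊆ A ∧ b ∈ acl L (S : Set C) := by
  obtain ⟨X, hX, hb⟩ := h
  obtain ⟨S, hS, hXS⟩ := Set.definable_iff_finitely_definable.1 hX
  exact ⟨S, hS, X, hXS, hb⟩

theorem exists_formula_of_mem_acl {β : Type} [Finite β] {c : β → C} {b : C}
    (h : b ∈ acl L (Set.range c)) : ∃ (N : ℕ) (φ : L.Formula (Fin 1 ⊕ β)),
      (∀ d : β → C, {x | φ.Realize (Sum.elim (fun _ => x) d)}.encard ≤ N) ∧
        φ.Realize (Sum.elim (fun _ => b) c) := by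
  have h' := realPt_mem_aclEq_realSet.2 h
  have hr : realSet L (Set.range c) = ∅ ∪ Set.range fun t => realPt L (c t) := by
    rw [Set.empty_union]
    exact (Set.range_comp _ _).symm
  rw [hr, mem_aclEq_union_range_iff] at h'
  obtain ⟨N, W, hW, hN, hb⟩ := h'
  obtain ⟨φ, hφ⟩ : ∃ φ : L.Formula (Fin 1 ⊕ (Σ _ : β, Fin 1)), ∀ v : Fin 1 ⊕ (Σ _ : β, Fin 1) → C,
      W (realTuple L (v ∘ Sum.inl)) (fun t => realTuple L fun j => v (Sum.inr ⟨t, j⟩)) ↔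
        φ.Realize v := by
    obtain ⟨φ, hφ⟩ := Set.empty_definable_iff.1 hW.empty_definable
    exact ⟨φ, Set.ext_iff.1 hφ⟩
  have key : ∀ x d, (φ.relabel (Sum.map id Sigma.fst) : L.Formula (Fin 1 ⊕ β)).Realize
      (Sum.elim (fun _ => x) d) ↔ W (realTuple L fun _ => x) fun t => realTuple L fun _ => d t := by
    intro x d
    exact Language.Formula.realize_relabel.trans (hφ _).symm
  refine ⟨N, φ.relabel (Sum.map id Sigma.fst), fun d => ?_, (key _ _).2 hb⟩
  refine le_trans ?_ (hN fun t => realTuple L fun _ => d t)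
  have hinj : Function.Injective fun x : C => realTuple L (fun _ : Fin 1 => x) :=
    fun x y h => congrFun (realTuple_injective 1 h) 0
  rw [← hinj.encard_image]
  refine Set.encard_le_encard ?_
  rintro _ ⟨x, hx, rfl⟩
  exact (key x d).1 hx

theorem mem_acl_of_formula {N : Type u} [L.Structure N] {β : Type} [Finite β] {c : β → N} {b : N}
    (φ : L.Formula (Fin 1 ⊕ β)) (hfin : {x | φ.Realize (Sum.elim (fun _ => x) c)}.Finite)
    (hb : φ.Realize (Sum.elim (fun _ => b) c)) : b ∈ acl L (Set.range c) := by
  refine ⟨_, ?_, hfin, hb⟩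
  have h1 : (∅ : Set N).Definable L {v : β ⊕ Fin 1 → N | φ.Realize (v ∘ Sum.swap)} := by
    refine Set.empty_definable_iff.2 ⟨φ.relabel Sum.swap, ?_⟩
    ext v
    exact Language.Formula.realize_relabel.symm
  have h2 := definable_elim (h1.mono (Set.empty_subset (Set.range c))) (c := c) fun i => ⟨i, rfl⟩
  unfold Set.Definable₁
  convert! h2 using 1
  ext v
  refine iff_of_eq (congrArg φ.Realize (funext fun x => ?_))
  rcases x with x | x
  · exact congrArg v (Subsingleton.elim _ _)
  · rfl

theorem exists_range_eq_finset {X : Type*} (S : Finset X) :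
    ∃ d : Fin S.card → X, Set.range d = S := by
  refine ⟨fun i => S.equivFin.symm i, ?_⟩
  ext x
  constructor
  · rintro ⟨i, rfl⟩
    exact (S.equivFin.symm i).2
  · intro hx
    exact ⟨S.equivFin ⟨x, hx⟩, by simp⟩

theorem realize_coe_iff (N : L.ElementarySubstructure C) {α : Type*} (φ : L.Formula α) (v : α → N) :
    φ.Realize (fun i => (v i : C)) ↔ φ.Realize v :=
  N.subtype.map_formula φ v

theorem coe_mem_acl_iff (N : L.ElementarySubstructure C) {A : Set N} {b : N} :
    (b : C) ∈ acl L ((fun x : N => (x : C)) '' A) ↔ b ∈ acl L A := by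
  constructor
  · intro h
    obtain ⟨S, hS, hb⟩ := exists_finite_of_mem_acl h
    obtain ⟨d, hd⟩ := exists_range_eq_finset S
    rw [← hd] at hb
    obtain ⟨k, φ, hφ, hb⟩ := exists_formula_of_mem_acl hb
    choose c hcA hc using fun i : Fin S.card => hS (hd.le ⟨i, rfl⟩)
    have hre : ∀ x : N, φ.Realize (Sum.elim (fun _ => (x : C)) d) ↔
        φ.Realize (Sum.elim (fun _ => x) c) := by
      intro x
      rw [← realize_coe_iff]
      refine iff_of_eq (congrArg φ.Realize (funext fun y => ?_))
      rcases y with y | y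
      · rfl
      · exact (hc y).symm
    refine acl_mono ?_ (mem_acl_of_formula (c := c) φ ?_ ((hre b).1 hb))
    · rintro _ ⟨i, rfl⟩
      exact hcA i
    · refine ((Set.finite_of_encard_le_coe (hφ d)).preimage
        Subtype.val_injective.injOn).subset fun x hx => ?_
      exact (hre x).2 hx
  · rintro ⟨X, hX, hfin, hb⟩
    obtain ⟨φ, hφ⟩ := Set.definable_iff_exists_formula_sum.1 hX
    have hφ' : ∀ x : N, φ.Realize (Sum.elim (fun a : A => (a : N)) fun _ => x) ↔ x ∈ X := fun x =>
      (Set.ext_iff.1 hφ fun _ => x).symm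
    have : Finite X := hfin
    let ψ : L.Formula N := ((φ.relabel (Sum.map (fun a : A => (a : N)) id)).imp
      (Language.Formula.iSup fun x : X => (Language.Term.var (Sum.inr 0)).equal
        (Language.Term.var (Sum.inl (x : N))))).iAlls (Fin 1)
    have hψ : ψ.Realize (id : N → N) := by
      rw [Language.Formula.realize_iAlls]
      intro x
      rw [Language.Formula.realize_imp, Language.Formula.realize_relabel,
        Language.Formula.realize_iSup]
      intro h
      refine ⟨⟨x 0, (hφ' _).1 ?_⟩, by simp⟩
      convert! h using 1
      ext1 y
      rcases y with y | y
      · rfl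
      · exact congrArg x (Subsingleton.elim _ _)
    rw [← realize_coe_iff, Language.Formula.realize_iAlls] at hψ
    have hsub : {x : C | φ.Realize (Sum.elim (fun a : A => ((a : N) : C)) fun _ => x)} ⊆
        (fun x : N => (x : C)) '' X := by
      intro x hx
      have h := hψ fun _ => x
      rw [Language.Formula.realize_imp, Language.Formula.realize_relabel,
        Language.Formula.realize_iSup] at h
      obtain ⟨y, hy⟩ := h (by
        have hx' : φ.Realize (Sum.elim (fun a : A => ((a : N) : C)) fun _ => x) := hx
        convert! hx' using 1
        ext1 y
        rcases y with y | y <;> rfl)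
      refine ⟨y, y.2, ?_⟩
      simpa using hy.symm
    refine ⟨_, ?_, (hfin.image _).subset hsub, ?_⟩
    · refine Set.definable_iff_exists_formula_sum.2 ⟨φ.relabel (Sum.map (fun a : A =>
        (⟨a, Set.mem_image_of_mem _ a.2⟩ : ((fun x : N => (x : C)) '' A : Set C))) id), ?_⟩
      ext v
      refine Iff.trans ?_ Language.Formula.realize_relabel.symm
      refine iff_of_eq (congrArg φ.Realize (funext fun y => ?_))
      rcases y with y | y
      · rfl
      · exact congrArg v (Subsingleton.elim _ _)
    · have := (realize_coe_iff N φ _).2 ((hφ' b).2 hb)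
      change φ.Realize _
      convert! this using 1
      ext1 y
      rcases y with y | y <;> rfl

/-! ### Transfer of the exchange property -/

theorem exists_sequence_independent {S : Set C} (hS : S.Finite) :
    ∃ (k : ℕ) (d : Fin k → C), (∀ i, d i ∉ acl L (d '' Set.Ioi i)) ∧ Set.range d ⊆ S ∧
      S ⊆ acl L (Set.range d) := by
  induction S, hS using Set.Finite.induction_on with
  | empty => exact ⟨0, Fin.elim0, fun i => i.elim0, by simp, by simp⟩
  | @insert x S _ _ ih =>
    obtain ⟨k, d, hd, hdS, hSd⟩ := ih
    by_cases hx : x ∈ acl L (Set.range d)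
    · exact ⟨k, d, hd, hdS.trans (Set.subset_insert _ _), Set.insert_subset hx hSd⟩
    · refine ⟨k + 1, Fin.cons x d, fun i => ?_, ?_, ?_⟩
      · refine Fin.cases ?_ (fun i => ?_) i
        · refine fun h => hx (acl_mono ?_ h)
          rintro _ ⟨j, hj, rfl⟩
          obtain ⟨j, rfl⟩ := Fin.exists_succ_eq_of_ne_zero (ne_of_gt hj)
          exact ⟨j, rfl⟩
        · refine fun h => hd i (acl_mono ?_ h)
          rintro _ ⟨j, hj, rfl⟩
          obtain ⟨j, rfl⟩ := Fin.exists_succ_eq_of_ne_zero ((Fin.succ_pos i).trans hj).ne'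
          exact ⟨j, Fin.succ_lt_succ_iff.1 hj, rfl⟩
      · rw [Fin.range_cons]
        exact Set.insert_subset_insert hdS
      · rw [Fin.range_cons]
        exact Set.insert_subset (subset_acl _ (Set.mem_insert _ _))
          (hSd.trans (acl_mono (Set.subset_insert _ _)))

theorem WeaklyOmegaSaturated.steinitzExchange {M : L.ElementarySubstructure C}
    (hsat : WeaklyOmegaSaturated M) (hexch : SteinitzExchange L M) : SteinitzExchange L C := by
  intro A a b hab ha
  by_contra hb
  obtain ⟨S, hS, haS⟩ := exists_finite_of_mem_acl hab
  have hSA : (S : Set C) \ {b} ⊆ A := by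
    rintro x ⟨hx, hxb⟩
    exact (hS hx).resolve_left hxb
  obtain ⟨k, d, hd, hdS, hSd⟩ := exists_sequence_independent (L := L)
    (S.finite_toSet.subset Set.sdiff_subset : ((S : Set C) \ {b}).Finite)
  have hdA := hdS.trans hSA
  have ha' : a ∈ acl L (Set.range (Fin.cons b d : Fin (k + 1) → C)) := by
    refine acl_subset_of_subset ?_ haS
    intro x hx
    rw [Fin.range_cons]
    by_cases hxb : x = b
    · exact subset_acl _ (Or.inl hxb)
    · exact acl_mono (Set.subset_insert _ _) (hSd ⟨hx, hxb⟩)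
  obtain ⟨N, φ, hφ, haφ⟩ := exists_formula_of_mem_acl ha'
  let σ : Fin 1 ⊕ Fin (k + 1) → Fin (k + 2) ⊕ Fin 0 :=
    Sum.elim (fun _ => Sum.inl 1) (Fin.cons (Sum.inl 0) fun j => Sum.inl j.succ.succ)
  have hσ : ∀ {N : Type u} (t : Fin (k + 2) → N) (c : Fin 0 → N), Sum.elim t c ∘ σ =
      Sum.elim (fun _ => t 1) (Fin.cons (t 0) fun j => t j.succ.succ) := by
    intro N t c
    ext1 x
    rcases x with x | x
    · rfl
    · refine Fin.cases ?_ (fun j => ?_) x <;> rfl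
  obtain ⟨s, hs, hsi⟩ := hsat 0 (k + 2) Fin.elim0 (φ.relabel σ)
    ⟨Fin.cons b (Fin.cons a d), by
      rw [Language.Formula.realize_relabel, hσ]
      exact haφ, fun i => by
      have hr : Set.range (fun j : Fin 0 => ((Fin.elim0 j : M) : C)) = ∅ :=
        Set.range_eq_empty _
      rw [hr, Set.union_empty]
      refine Fin.cases ?_ (fun i => ?_) i
      · refine fun h => hb (acl_mono ?_ h)
        rintro _ ⟨j, hj, rfl⟩
        obtain ⟨j, rfl⟩ := Fin.exists_succ_eq_of_ne_zero (ne_of_gt hj)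
        refine Fin.cases ?_ (fun j => ?_) j
        · exact Or.inl rfl
        · exact Or.inr (hdA ⟨j, rfl⟩)
      · refine Fin.cases ?_ (fun i => ?_) i
        · refine fun h => ha (acl_mono ?_ h)
          rintro _ ⟨j, hj, rfl⟩
          obtain ⟨j, rfl⟩ := Fin.exists_succ_eq_of_ne_zero ((Fin.succ_pos _).trans hj).ne'
          obtain ⟨j, rfl⟩ := Fin.exists_succ_eq_of_ne_zero (Fin.succ_lt_succ_iff.1 hj).ne'
          exact hdA ⟨j, rfl⟩
        · refine fun h => hd i (acl_mono ?_ h)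
          rintro _ ⟨j, hj, rfl⟩
          obtain ⟨j, rfl⟩ := Fin.exists_succ_eq_of_ne_zero ((Fin.succ_pos _).trans hj).ne'
          have hj' := Fin.succ_lt_succ_iff.1 hj
          obtain ⟨j, rfl⟩ := Fin.exists_succ_eq_of_ne_zero ((Fin.succ_pos _).trans hj').ne'
          exact ⟨j, Fin.succ_lt_succ_iff.1 hj', rfl⟩⟩
  rw [Language.Formula.realize_relabel, hσ] at hs
  have h1 : s 1 ∈ acl L (Set.range (Fin.cons (s 0) fun j => s j.succ.succ : Fin (k + 1) → M)) := by
    refine mem_acl_of_formula φ ?_ hs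
    refine ((Set.finite_of_encard_le_coe (hφ fun j => ((Fin.cons (s 0) fun j => s j.succ.succ :
      Fin (k + 1) → M) j : C))).preimage Subtype.val_injective.injOn).subset fun x hx => ?_
    have := (realize_coe_iff M φ _).2 hx
    change φ.Realize _
    convert! this using 1
    ext1 y
    rcases y with y | y <;> rfl
  rw [Fin.range_cons] at h1
  refine hsi 0 (acl_mono ?_ (hexch _ _ _ h1 fun h => hsi 1 (acl_mono ?_ h)))
  · rintro _ (rfl | ⟨j, rfl⟩)
    · exact Or.inl ⟨1, Fin.succ_pos 0, rfl⟩
    · exact Or.inl ⟨_, Fin.succ_pos _, rfl⟩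
  · rintro _ ⟨j, rfl⟩
    exact Or.inl ⟨_, Fin.succ_lt_succ_iff.2 (Fin.succ_pos j), rfl⟩

end

section
variable {L : FirstOrder.Language.{v, w}} {C : Type u} [L.Structure C]

/-! ### Exchange over imaginaries and independence of real tuples -/

theorem GeometricEI.exists_real_aclEq_eq (hEI : GeometricEI L C) (A : Set (Imag L C)) :
    ∃ R : Set C, aclEq (realSet L R) = aclEq A := by
  choose x hx using hEI
  refine ⟨⋃ e ∈ A, (x e : Set C), (aclEq_subset_of_subset ?_).antisymm (aclEq_subset_of_subset ?_)⟩
  · rintro _ ⟨a, ha, rfl⟩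
    obtain ⟨e, he, ha⟩ := Set.mem_iUnion₂.1 ha
    refine aclEq_mono (Set.singleton_subset_iff.2 he) ?_
    rw [hx e]
    exact subset_aclEq _ (realPt_mem_realSet.2 ha)
  · intro e he
    have h1 : e ∈ aclEq (realSet L (x e : Set C)) := by
      rw [← hx e]
      exact subset_aclEq _ rfl
    exact aclEq_mono (realSet_mono (Set.subset_biUnion_of_mem (u := fun e => (x e : Set C)) he)) h1

theorem aclEq_insert_congr {A B : Set (Imag L C)} (h : aclEq A = aclEq B) (e : Imag L C) :
    aclEq (insert e A) = aclEq (insert e B) := by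
  have : ∀ {A B : Set (Imag L C)}, aclEq A = aclEq B → aclEq (insert e A) ⊆ aclEq (insert e B) := by
    intro A B h
    refine aclEq_subset_of_subset (Set.insert_subset (subset_aclEq _ (Set.mem_insert _ _)) ?_)
    exact ((subset_aclEq A).trans h.le).trans (aclEq_mono (Set.subset_insert _ _))
  exact (this h).antisymm (this h.symm)

/-- Exchange for real elements over a set of imaginaries. -/
theorem realPt_mem_aclEq_exchange (hex : SteinitzExchange L C) (hEI : GeometricEI L C)
    {A : Set (Imag L C)} {x y : C} (hx : realPt L x ∈ aclEq (insert (realPt L y) A))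
    (hxA : realPt L x ∉ aclEq A) : realPt L y ∈ aclEq (insert (realPt L x) A) := by
  obtain ⟨R, hR⟩ := hEI.exists_real_aclEq_eq A
  rw [← hR, realPt_mem_aclEq_realSet] at hxA
  rw [aclEq_insert_congr hR.symm, ← realSet_insert, realPt_mem_aclEq_realSet] at hx ⊢
  exact hex R x y hx hxA

/-- The coordinates `aᵢ`, `i ∈ I`, are pairwise distinct and algebraically independent over `A`. -/
def IndepOver (A : Set (Imag L C)) {n : ℕ} (a : Fin n → C) (I : Finset (Fin n)) : Prop :=
  ∀ i ∈ I, realPt L (a i) ∉ aclEq (A ∪ realSet L (a '' (I.erase i : Finset (Fin n))))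

variable {n : ℕ} {a : Fin n → C} {I J : Finset (Fin n)} {A B E : Set (Imag L C)}

theorem aclEq_union_subset (h : A ⊆ aclEq B) (D : Set (Imag L C)) :
    aclEq (A ∪ D) ⊆ aclEq (B ∪ D) :=
  aclEq_subset_of_subset (Set.union_subset (h.trans (aclEq_mono Set.subset_union_left))
    (Set.subset_union_right.trans (subset_aclEq _)))

theorem IndepOver.of_subset_aclEq (h : IndepOver B a I) (hA : A ⊆ aclEq B) : IndepOver A a I :=
  fun i hi hmem => h i hi (aclEq_union_subset hA _ hmem)

theorem IndepOver.mono (h : IndepOver B a I) (hA : A ⊆ B) : IndepOver A a I :=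
  h.of_subset_aclEq (hA.trans (subset_aclEq _))

theorem IndepOver.subset (h : IndepOver A a I) (hJ : J ⊆ I) : IndepOver A a J :=
  fun i hi hmem => h i (hJ hi) (aclEq_mono (Set.union_subset_union_right _
    (realSet_mono (Set.image_mono (Finset.coe_subset.2 (Finset.erase_subset_erase _ hJ))))) hmem)

theorem IndepOver.injOn (h : IndepOver A a I) : Set.InjOn a I := by
  intro i hi j hj hij
  by_contra hne
  exact h i hi (subset_aclEq _ (Or.inr (realPt_mem_realSet.2
    ⟨j, Finset.mem_coe.2 (Finset.mem_erase.2 ⟨Ne.symm hne, hj⟩), hij.symm⟩)))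

theorem union_realSet_image_insert (A : Set (Imag L C)) (a : Fin n → C) (i : Fin n)
    (I : Finset (Fin n)) : A ∪ realSet L (a '' (insert i I : Finset (Fin n))) =
      insert (realPt L (a i)) (A ∪ realSet L (a '' I)) := by
  rw [Finset.coe_insert, Set.image_insert_eq, realSet_insert, Set.union_insert]

theorem realPt_notMem_of_indepOver_insert (hex : SteinitzExchange L C) (hEI : GeometricEI L C)
    {x : C} (hx : realPt L x ∉ aclEq E) (h : IndepOver (insert (realPt L x) E) a I) :
    realPt L x ∉ aclEq (E ∪ realSet L (a '' I)) := by
  induction I using Finset.induction_on with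
  | empty => simpa [realSet_empty] using hx
  | insert i I hi ih =>
    intro hmem
    rw [union_realSet_image_insert] at hmem
    refine h i (Finset.mem_insert_self _ _) ?_
    rw [Finset.erase_insert hi, Set.insert_union]
    exact realPt_mem_aclEq_exchange hex hEI hmem (ih (h.subset (Finset.subset_insert _ _)))

theorem notMem_of_indepOver_insert (hex : SteinitzExchange L C) (hEI : GeometricEI L C)
    {e : Imag L C} (he : e ∉ aclEq E) (h : IndepOver (insert e E) a I) :
    e ∉ aclEq (E ∪ realSet L (a '' I)) := by
  intro hmem
  obtain ⟨x, hx⟩ := hEI e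
  obtain ⟨y, hy, hyE⟩ : ∃ y ∈ x, realPt L y ∉ aclEq E := by
    by_contra! hall
    refine he (aclEq_subset_of_subset (B := realSet L (x : Set C)) ?_ ?_)
    · rintro _ ⟨y, hy, rfl⟩
      exact hall y hy
    · rw [← hx]
      exact subset_aclEq _ rfl
  have hye : realPt L y ∈ aclEq {e} := by
    rw [hx]
    exact subset_aclEq _ (realPt_mem_realSet.2 hy)
  refine realPt_notMem_of_indepOver_insert hex hEI hyE (h.of_subset_aclEq ?_)
    (aclEq_subset_of_subset (Set.singleton_subset_iff.2 hmem) hye)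
  refine Set.insert_subset (aclEq_mono ?_ hye) ?_
  · exact Set.singleton_subset_iff.2 (Set.mem_insert _ _)
  · exact (Set.subset_insert _ _).trans (subset_aclEq _)

theorem IndepOver.insert (hex : SteinitzExchange L C) (hEI : GeometricEI L C) {i : Fin n}
    (h : IndepOver A a I) (hi : realPt L (a i) ∉ aclEq (A ∪ realSet L (a '' I))) :
    IndepOver A a (insert i I) := by
  have hiI : i ∉ I := fun hiI => hi (subset_aclEq _ (Or.inr (realPt_mem_realSet.2 ⟨i, hiI, rfl⟩)))
  intro j hj hmem
  rcases Finset.mem_insert.1 hj with rfl | hj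
  · rw [Finset.erase_insert hiI] at hmem
    exact hi hmem
  · have hne : i ≠ j := fun h => hiI (h ▸ hj)
    rw [Finset.erase_insert_of_ne hne, union_realSet_image_insert] at hmem
    have := realPt_mem_aclEq_exchange hex hEI hmem (h j hj)
    rw [← union_realSet_image_insert, Finset.insert_erase hj] at this
    exact hi this

theorem indepOver_insert_iff (hex : SteinitzExchange L C) (hEI : GeometricEI L C) {i : Fin n}
    (hiI : i ∉ I) : IndepOver A a (Insert.insert i I) ↔ realPt L (a i) ∉ aclEq A ∧
      IndepOver (Insert.insert (realPt L (a i)) A) a I := by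
  constructor
  · refine fun h => ⟨fun hmem => h i (Finset.mem_insert_self _ _)
      (aclEq_mono Set.subset_union_left hmem), fun j hj hmem => ?_⟩
    have hne : i ≠ j := fun h => hiI (h ▸ hj)
    refine h j (Finset.mem_insert_of_mem hj) ?_
    rwa [Finset.erase_insert_of_ne hne, union_realSet_image_insert, ← Set.insert_union]
  · rintro ⟨h1, h2⟩
    exact (h2.mono (Set.subset_insert _ _)).insert hex hEI
      (realPt_notMem_of_indepOver_insert hex hEI h1 h2)

/-- The dimension of `a` over `A` is at least `k`. -/
def DimGE (A : Set (Imag L C)) (a : Fin n → C) (k : ℕ) : Prop :=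
  ∃ I : Finset (Fin n), I.card = k ∧ IndepOver A a I

theorem DimGE.zero : DimGE A a 0 :=
  ⟨∅, rfl, fun i hi => absurd hi (Finset.notMem_empty i)⟩

theorem DimGE.le {k : ℕ} (h : DimGE A a k) : k ≤ n := by
  obtain ⟨I, rfl, -⟩ := h
  simpa using I.card_le_univ

theorem DimGE.mono {k : ℕ} (h : DimGE B a k) (hAB : A ⊆ B) : DimGE A a k :=
  h.imp fun _ hI => ⟨hI.1, hI.2.mono hAB⟩

theorem DimGE.anti {k l : ℕ} (h : DimGE A a k) (hl : l ≤ k) : DimGE A a l := by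
  obtain ⟨I, rfl, hI⟩ := h
  obtain ⟨J, hJI, hJ⟩ := Finset.exists_subset_card_eq hl
  exact ⟨J, hJ, hI.subset hJI⟩

theorem IndepOver.spans (hex : SteinitzExchange L C) (hEI : GeometricEI L C)
    (h : IndepOver A a I) (hmax : ¬ DimGE A a (I.card + 1)) (j : Fin n) :
    realPt L (a j) ∈ aclEq (A ∪ realSet L (a '' I)) := by
  by_contra hj
  have hjI : j ∉ I := fun hjI => hj (subset_aclEq _ (Or.inr (realPt_mem_realSet.2 ⟨j, hjI, rfl⟩)))
  exact hmax ⟨_, Finset.card_insert_of_notMem hjI, h.insert hex hEI hj⟩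

theorem exists_algIndependent_iff_dimGE {B : Set C} {k : ℕ} :
    (∃ S : Finset C, (S : Set C) ⊆ Set.range a ∧ AlgIndependent L B S ∧ S.card = k) ↔
      DimGE (realSet L B) a k := by
  classical
  constructor
  · rintro ⟨S, hS, hind, rfl⟩
    choose f hf using fun s : S => hS s.2
    have hinj : Function.Injective f := by
      intro s t h
      rw [← Subtype.coe_inj, ← hf s, ← hf t, h]
    refine ⟨Finset.univ.image f, ?_, ?_⟩
    · rw [Finset.card_image_of_injective _ hinj]
      simp
    · intro i hi hmem
      obtain ⟨s, -, rfl⟩ := Finset.mem_image.1 hi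
      rw [← realSet_union, realPt_mem_aclEq_realSet, hf s] at hmem
      refine hind s s.2 (acl_mono (Set.union_subset_union_right _ ?_) hmem)
      rintro _ ⟨j, hj, rfl⟩
      obtain ⟨hne, hj⟩ := Finset.mem_erase.1 (Finset.mem_coe.1 hj)
      obtain ⟨t, -, rfl⟩ := Finset.mem_image.1 hj
      rw [hf t]
      refine ⟨t.2, fun h => hne ?_⟩
      rw [Subtype.coe_injective (Set.mem_singleton_iff.1 h)]
  · rintro ⟨I, rfl, hI⟩
    refine ⟨I.image a, ?_, ?_, Finset.card_image_of_injOn hI.injOn⟩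
    · intro x hx
      obtain ⟨i, -, rfl⟩ := Finset.mem_image.1 (Finset.mem_coe.1 hx)
      exact ⟨i, rfl⟩
    · intro s hs hmem
      obtain ⟨i, hi, rfl⟩ := Finset.mem_image.1 (Finset.mem_coe.1 hs)
      refine hI i hi ?_
      rw [← realSet_union, realPt_mem_aclEq_realSet]
      refine acl_mono (Set.union_subset_union_right _ ?_) hmem
      rintro x ⟨hx, hne⟩
      obtain ⟨j, hj, rfl⟩ := Finset.mem_image.1 (Finset.mem_coe.1 hx)
      exact ⟨j, Finset.mem_coe.2 (Finset.mem_erase.2 ⟨fun h => hne (by rw [h]; rfl), hj⟩), rfl⟩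

theorem le_algDim_iff {B : Set C} {k : ℕ} : k ≤ algDim L B a ↔ DimGE (realSet L B) a k := by
  have hT : {d | ∃ S : Finset C, (S : Set C) ⊆ Set.range a ∧ AlgIndependent L B S ∧ S.card = d} =
      {d | DimGE (realSet L B) a d} := Set.ext fun d => exists_algIndependent_iff_dimGE
  have hbdd : BddAbove {d | DimGE (realSet L B) a d} := ⟨n, fun d hd => DimGE.le hd⟩
  unfold algDim
  rw [hT]
  constructor
  · intro h
    have h0 : sSup {d | DimGE (realSet L B) a d} ∈ {d | DimGE (realSet L B) a d} :=
      Nat.sSup_mem ⟨0, DimGE.zero⟩ hbdd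
    exact DimGE.anti h0 h
  · exact fun h => le_csSup hbdd h

/-! ### Types of real tuples -/

/-- Algebraicity is witnessed by formulas without further parameters. -/
theorem exists_defOver_of_mem_aclEq {D : Set (Imag L C)} {β τ : Type} [Finite τ]
    (S : ImagSort L C) (g : Fin S.arity → β) (T : τ → ImagSort L C)
    (h : ∀ t, Fin (T t).arity → β) (v : β → C)
    (hv : (⟨S, S.cls (v ∘ g)⟩ : Imag L C) ∈
      aclEq (D ∪ Set.range fun t => (⟨T t, (T t).cls (v ∘ h t)⟩ : Imag L C))) :
    ∃ W : Set (β → C), DefOver D W ∧ v ∈ W ∧ ∀ u ∈ W, (⟨S, S.cls (u ∘ g)⟩ : Imag L C) ∈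
      aclEq (D ∪ Set.range fun t => (⟨T t, (T t).cls (u ∘ h t)⟩ : Imag L C)) := by
  obtain ⟨N, W, hW, hN, hvW⟩ := (mem_aclEq_union_range_iff _ _).1 hv
  exact ⟨{u | W (S.cls (u ∘ g)) fun t => (T t).cls (u ∘ h t)},
    DefOver.comp (Sum.elim g fun p : (Σ t, Fin (T t).arity) => h p.1 p.2) hW, hvW, fun u hu =>
      (mem_aclEq_union_range_iff (fun t => (⟨T t, (T t).cls (u ∘ h t)⟩ : Imag L C))
        ⟨S, S.cls (u ∘ g)⟩).2 ⟨N, W, hW, hN, hu⟩⟩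

theorem range_realPt_eq (a : Fin n → C) (J : Finset (Fin n)) :
    Set.range (fun t : J => realPt L (a t)) = realSet L (a '' J) := by
  ext e
  simp [realSet]

theorem exists_defOver_of_realPt_mem_aclEq {i : Fin n}
    (h : realPt L (a i) ∈ aclEq (A ∪ realSet L (a '' J))) :
    ∃ W : Set (Fin n → C), DefOver A W ∧ a ∈ W ∧
      ∀ u ∈ W, realPt L (u i) ∈ aclEq (A ∪ realSet L (u '' J)) := by
  rw [← range_realPt_eq] at h
  obtain ⟨W, hW, haW, h⟩ := exists_defOver_of_mem_aclEq (realSort L C 1) (fun _ => i)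
    (fun _ : J => realSort L C 1) (fun t _ => t) a h
  refine ⟨W, hW, haW, fun u hu => ?_⟩
  rw [← range_realPt_eq]
  exact h u hu

theorem RealizesType.symm {S : ImagSort L C} {x y : S.Elem} (h : RealizesType A x y) :
    RealizesType A y x := by
  intro X hX hy
  by_contra hx
  exact h Xᶜ (eqDefinable_iff.2 hX.defOver.compl) hx hy

theorem RealizesType.mem_iff {b : Fin n → C} (h : RealizesType A (realTuple L a) (realTuple L b))
    {W : Set (Fin n → C)} (hW : DefOver A W) : a ∈ W ↔ b ∈ W := by
  have := hW.eqDefinable_image (S := realSort L C n)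
  have hinj : Function.Injective (realSort L C n).cls := realTuple_injective n
  exact hinj.mem_set_image.symm.trans
    (Iff.trans ⟨h _ this, h.symm _ this⟩ hinj.mem_set_image)

theorem realizesType_realTuple_iff {b : Fin n → C} :
    RealizesType A (realTuple L a) (realTuple L b) ↔
      ∀ W : Set (Fin n → C), DefOver A W → a ∈ W → b ∈ W :=
  ⟨fun h _ hW => (h.mem_iff hW).1, fun h _ hX => h _ hX.defOver⟩

theorem IndepOver.of_realizesType {b : Fin n → C} (hI : IndepOver A a I)
    (h : RealizesType A (realTuple L a) (realTuple L b)) : IndepOver A b I := by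
  intro i hi hmem
  obtain ⟨W, hW, hbW, hmem⟩ := exists_defOver_of_realPt_mem_aclEq hmem
  exact hI i hi (hmem a ((h.mem_iff hW).2 hbW))

theorem DimGE.of_realizesType {b : Fin n → C} {k : ℕ} (ha : DimGE A a k)
    (h : RealizesType A (realTuple L a) (realTuple L b)) : DimGE A b k :=
  ha.imp fun _ hI => ⟨hI.1, hI.2.of_realizesType h⟩

end

section
variable {L : FirstOrder.Language.{v, w}} {C : Type u} [L.Structure C] {κ : Cardinal.{u}}
variable {n : ℕ} {a : Fin n → C} {I J : Finset (Fin n)} {A B D : Set (Imag L C)}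

/-! ### Independent extensions -/

theorem RealizesType.mono {S : ImagSort L C} {x y : S.Elem} (h : RealizesType B x y)
    (hAB : A ⊆ B) : RealizesType A x y :=
  fun X hX => h X (hX.mono hAB)

theorem RealizesType.trans {S : ImagSort L C} {x y z : S.Elem} (h : RealizesType A x y)
    (h' : RealizesType A y z) : RealizesType A x z :=
  fun X hX hx => h' X hX (h X hX hx)

theorem IsMonster.exists_realizesType_coord_notMem (hC : IsMonster L C κ) (hBD : B ⊆ D)
    (hD : #D < κ) {i : Fin n} (hi : realPt L (a i) ∉ aclEq B) :
    ∃ b : Fin n → C, RealizesType B (realTuple L a) (realTuple L b) ∧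
      realPt L (b i) ∉ aclEq D := by
  obtain ⟨b, hb⟩ := hC.exists_forall_mem (α := Fin n) hD
    (ι := {W : Set (Fin n → C) // DefOver B W ∧ a ∈ W} ⊕
      {Z : Set (realSort L C 1).Elem // EqDefinable D Z ∧ Z.Finite})
    (Sum.elim (fun W => W.1) fun Z => {v | realTuple L (fun _ => v i) ∉ Z.1}) (by
      rintro (W | Z)
      · exact W.2.1.mono hBD
      · exact (Z.2.1.defOver.comp fun _ => i).not) (by
      intro s
      by_contra! hs
      have hW : DefOver B {v | ∀ W ∈ s.toLeft, v ∈ W.1} :=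
        DefOver.forall_finset _ fun W _ => W.2.1
      have hproj : DefOver B {w : Fin 1 → C | ∃ v : Fin n → C,
          (∀ W ∈ s.toLeft, v ∈ W.1) ∧ w 0 = v i} := by
        refine DefOver.exists' (P := fun (w : Fin 1 → C) (v : Fin n → C) =>
          (∀ W ∈ s.toLeft, v ∈ W.1) ∧ w 0 = v i) ?_
        exact (hW.comp Sum.inr).and (DefOver.eq_var _ _)
      refine hi ⟨_, hproj.eqDefinable_image (S := realSort L C 1), ?_, fun _ => a i,
        ⟨a, fun W _ => W.2.2, rfl⟩, rfl⟩
      refine (Set.Finite.biUnion s.toRight.finite_toSet fun Z _ => Z.2.2).subset ?_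
      rintro _ ⟨w, ⟨v, hv, hw⟩, rfl⟩
      obtain ⟨j, hj, hjv⟩ := hs v
      rcases j with W | Z
      · exact absurd (hv W (Finset.mem_toLeft.2 hj)) hjv
      · refine Set.mem_biUnion (Finset.mem_coe.2 (Finset.mem_toRight.2 hj)) ?_
        have hw' : w = fun _ => v i := funext fun j : Fin 1 => by
          rw [Subsingleton.elim j 0, hw]
        rw [hw']
        exact not_not.1 hjv)
  refine ⟨b, realizesType_realTuple_iff.2 fun W hW ha => hb (Sum.inl ⟨W, hW, ha⟩), ?_⟩
  rintro ⟨Z, hZ, hfin, hbZ⟩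
  exact hb (Sum.inr ⟨Z, hZ, hfin⟩) hbZ

/-- Independent coordinates can be kept independent over any small set when the tuple is replaced
by another realisation of its type. -/
theorem IsMonster.exists_realizesType_indepOver (hC : IsMonster L C κ)
    (hex : SteinitzExchange L C) (hEI : GeometricEI L C) (I : Finset (Fin n)) :
    ∀ {a : Fin n → C} {B D : Set (Imag L C)}, B ⊆ D → #D < κ → IndepOver B a I →
      ∃ b : Fin n → C, RealizesType B (realTuple L a) (realTuple L b) ∧ IndepOver D b I := by
  induction I using Finset.induction_on with
  | empty =>
    exact fun {a B D} _ _ _ => ⟨a, fun X _ h => h, fun i hi => absurd hi (Finset.notMem_empty i)⟩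
  | insert i I hi ih =>
    intro a B D hBD hD h
    obtain ⟨b, hab, hb⟩ := hC.exists_realizesType_coord_notMem hBD hD
      ((indepOver_insert_iff hex hEI hi).1 h).1
    obtain ⟨c, hbc, hc⟩ := ih (Set.insert_subset_insert (a := realPt L (b i)) hBD)
      (mk_insert_lt hC.aleph0_lt hD _)
      ((indepOver_insert_iff hex hEI hi).1 (h.of_realizesType hab)).2
    have hci : c i = b i := (hbc.mem_iff (W := {v | v i = b i})
      (DefOver.eq_const (Set.mem_insert _ _) i)).1 rfl
    refine ⟨c, hab.trans (hbc.mono (Set.subset_insert _ _)),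
      (indepOver_insert_iff hex hEI hi).2 ?_⟩
    rw [hci]
    exact ⟨hb, hc⟩

/-! ### þ-forking lowers the dimension -/

theorem EqFormula.defOver {S S' : ImagSort L C} (δ : EqFormula S S') {α : Type}
    (f : Fin S.arity → α) (g : Fin S'.arity → α) :
    DefOver A {v : α → C | δ.holds (S.cls (v ∘ f)) (S'.cls (v ∘ g))} :=
  (DefOver.base δ.definable).comp (Sum.elim f g)

theorem EqFormula.eqDefinable_and_holds {S S' : ImagSort L C} (δ : EqFormula S S') {x : S.Elem}
    (hx : (⟨S, x⟩ : Imag L C) ∈ A) {Y : Set S'.Elem} (hY : EqDefinable A Y) :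
    EqDefinable A {y | y ∈ Y ∧ δ.holds x y} := by
  refine eqDefinable_iff.2 (hY.defOver.and ?_)
  have h1 : DefOver A {w : Fin S'.arity → C | ∃ z : Fin S.arity → C,
      S.cls z = x ∧ δ.holds (S.cls z) (S'.cls w)} := by
    refine DefOver.exists' (P := fun (w : Fin S'.arity → C) (z : Fin S.arity → C) =>
      S.cls z = x ∧ δ.holds (S.cls z) (S'.cls w)) ?_
    exact (DefOver.cls_eq_param hx _).and (δ.defOver _ _)
  refine h1.congr fun w => ⟨fun h => ?_, ?_⟩
  · obtain ⟨z, rfl⟩ := S.exists_cls_eq x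
    exact ⟨z, rfl, h⟩
  · rintro ⟨z, rfl, h⟩
    exact h

theorem KInconsistent.encard_le {S S' : ImagSort L C} {δ : EqFormula S S'} {P : Set S'.Elem}
    {k : ℕ} (h : KInconsistent δ P k) (x : S.Elem) : {y | y ∈ P ∧ δ.holds x y}.encard ≤ k :=
  encard_le_of_forall_not_injective fun f hf hfP =>
    h f hf (fun i => (hfP i).1) ⟨x, fun i => (hfP i).2⟩

theorem IsMonster.exists_kInconsistent (hC : IsMonster L C κ) (hA : #A < κ)
    {S S' : ImagSort L C} {δ : EqFormula S S'} {e : S'.Elem} {k : ℕ}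
    (h : KInconsistent δ {e' | RealizesType A e e'} k) :
    ∃ Y : Set S'.Elem, EqDefinable A Y ∧ e ∈ Y ∧ KInconsistent δ Y k := by
  by_contra! hno
  obtain ⟨v, hv⟩ := hC.exists_forall_mem (α := Fin k × Fin S'.arity) hA
    (ι := {Y : Set S'.Elem // EqDefinable A Y ∧ e ∈ Y})
    (fun Y => {v | ((∀ i j, S'.cls (v ∘ fun l => (i, l)) = S'.cls (v ∘ fun l => (j, l)) → i = j) ∧
      ∀ i, S'.cls (v ∘ fun l => (i, l)) ∈ Y.1) ∧
        ∃ z, ∀ i, δ.holds (S.cls z) (S'.cls (v ∘ fun l => (i, l)))}) (by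
      intro Y
      refine ((DefOver.forall_finite fun i => DefOver.forall_finite fun j =>
        (DefOver.cls_eq S' _ _).imp (DefOver.const (i = j))).and
          (DefOver.forall_finite fun i => Y.2.1.defOver.comp _)).and ?_
      refine DefOver.exists' (P := fun (v : Fin k × Fin S'.arity → C) (z : Fin S.arity → C) =>
        ∀ i, δ.holds (S.cls z) (S'.cls (v ∘ fun l => (i, l)))) ?_
      exact DefOver.forall_finite fun i => δ.defOver Sum.inr fun l => Sum.inl (i, l)) (by
      intro s
      have hs : EqDefinable A {y | ∀ Y ∈ s, y ∈ Y.1} :=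
        eqDefinable_iff.2 (DefOver.forall_finset _ fun Y _ => Y.2.1.defOver)
      have hn := hno _ hs fun Y _ => Y.2.2
      unfold KInconsistent at hn
      push Not at hn
      obtain ⟨f, hf, hfs, x, hx⟩ := hn
      choose r hr using fun i => S'.exists_cls_eq (f i)
      obtain ⟨z, rfl⟩ := S.exists_cls_eq x
      have hr' : ∀ i, S'.cls ((fun p : Fin k × Fin S'.arity => r p.1 p.2) ∘ fun l => (i, l)) =
        f i := hr
      refine ⟨fun p => r p.1 p.2, fun Y hY => ⟨⟨fun i j hij => ?_, fun i => ?_⟩, z, fun i => ?_⟩⟩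
      · rw [hr', hr'] at hij
        exact hf hij
      · rw [hr']
        exact hfs i Y hY
      · rw [hr']
        exact hx i)
  have h0 := hv ⟨Set.univ, eqDefinable_iff.2 (DefOver.const True), trivial⟩
  obtain ⟨⟨hinj, -⟩, z, hz⟩ := h0
  exact h (fun i => S'.cls (v ∘ fun l => (i, l))) hinj
    (fun i X hX he => (hv ⟨X, hX, he⟩).1.2 i) ⟨_, hz⟩

theorem IsMonster.mem_aclEq_of_kInconsistent (hC : IsMonster L C κ) (hA : #A < κ)
    {S S' : ImagSort L C} {δ : EqFormula S S'} {e : S'.Elem} {k : ℕ}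
    (h : KInconsistent δ {e' | RealizesType A e e'} k) {x : S.Elem} (hx : δ.holds x e) :
    (⟨S', e⟩ : Imag L C) ∈ aclEq (insert ⟨S, x⟩ A) := by
  obtain ⟨Y, hY, heY, hYk⟩ := hC.exists_kInconsistent hA h
  exact ⟨_, δ.eqDefinable_and_holds (Set.mem_insert _ _) (hY.mono (Set.subset_insert _ _)),
    Set.finite_of_encard_le_coe (hYk.encard_le x), heY, hx⟩

theorem DimGE.succ_of_typeThornForks (hC : IsMonster L C κ) (hex : SteinitzExchange L C)
    (hEI : GeometricEI L C) (hAB : A ⊆ B) (hB : #B < κ) {k : ℕ} (hk : DimGE B a k)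
    (hfork : TypeThornForks (realTuple L a) B A) : DimGE A a (k + 1) := by
  by_contra hmax
  obtain ⟨I, rfl, hI⟩ := hk
  have hspan := (hI.mono hAB).spans hex hEI hmax
  obtain ⟨X, hX, haX, m, S', δ, e, hdiv, hcover⟩ := hfork
  choose c hc k hk using hdiv
  let D : Set (Imag L C) := B ∪ (Set.range (fun i => (⟨S' i, e i⟩ : Imag L C)) ∪ Set.range c)
  have hD : #D < κ := mk_union_lt hC.aleph0_lt hB
    (mk_lt_of_finite hC.aleph0_lt ((Set.finite_range _).union (Set.finite_range _)))
  obtain ⟨b, hab, hb⟩ := hC.exists_realizesType_indepOver hex hEI I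
    (Set.subset_union_left : B ⊆ D) hD hI
  obtain ⟨i, hi⟩ := Set.mem_iUnion.1 (hcover (hab X hX haX))
  have hbspan : tuplePt L b ∈ aclEq (A ∪ realSet L (b '' I)) := by
    rw [← aclEq_idem]
    refine tuplePt_mem_aclEq fun j => ?_
    obtain ⟨W, hW, haW, hWmem⟩ := exists_defOver_of_realPt_mem_aclEq (hspan j)
    exact hWmem b (((hab.mono hAB).mem_iff hW).1 haW)
  have hA : #A < κ := (mk_le_mk_of_subset hAB).trans_lt hB
  have he := hC.mem_aclEq_of_kInconsistent (mk_insert_lt hC.aleph0_lt hA (c i)) (hk i) hi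
  refine notMem_of_indepOver_insert hex hEI (hc i) (hb.mono ?_) (aclEq_subset_of_subset ?_ he)
  · refine Set.insert_subset (Or.inr (Or.inl ⟨i, rfl⟩)) (Set.insert_subset (Or.inr (Or.inr ⟨i, rfl⟩)) ?_)
    exact hAB.trans Set.subset_union_left
  · refine Set.insert_subset (aclEq_mono ?_ hbspan) ?_
    · exact Set.union_subset_union_left _ (Set.subset_insert _ _)
    · exact Set.subset_union_left.trans (subset_aclEq _)

end

section
variable {L : FirstOrder.Language.{v, w}} {C : Type u} [L.Structure C] {κ : Cardinal.{u}}
variable {n : ℕ} {a : Fin n → C} {A B T : Set C}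

/-! ### A drop of the dimension yields þ-forking -/

/-- A formula between real tuples as an `L^eq`-formula. -/
def EqFormula.ofFormula {m : ℕ} (φ : L.Formula (Fin n ⊕ Fin m)) :
    EqFormula (realSort L C n) (realSort L C m) where
  holds x y := ∃ x' y', realTuple L x' = x ∧ realTuple L y' = y ∧ φ.Realize (Sum.elim x' y')
  definable := by
    have h : ∀ v : Fin n ⊕ Fin m → C, (∃ x' y', realTuple L x' = realTuple L (v ∘ Sum.inl) ∧
        realTuple L y' = realTuple L (v ∘ Sum.inr) ∧ φ.Realize (Sum.elim x' y')) ↔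
          φ.Realize v := by
      refine fun v => ⟨?_, fun h => ⟨_, _, rfl, rfl, by rwa [Sum.elim_comp_inl_inr]⟩⟩
      rintro ⟨x, y, hx, hy, h⟩
      rwa [realTuple_injective _ hx, realTuple_injective _ hy, Sum.elim_comp_inl_inr] at h
    exact Set.empty_definable_iff.2 ⟨φ, Set.ext h⟩

theorem EqFormula.ofFormula_holds_iff {m : ℕ} (φ : L.Formula (Fin n ⊕ Fin m)) (x : Fin n → C)
    (y : Fin m → C) : (EqFormula.ofFormula φ).holds (realTuple L x) (realTuple L y) ↔
      φ.Realize (Sum.elim x y) := by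
  constructor
  · rintro ⟨x', y', hx, hy, h⟩
    rwa [realTuple_injective _ hx, realTuple_injective _ hy] at h
  · exact fun h => ⟨x, y, rfl, rfl, h⟩

theorem EqFormula.eqDefinable_ofFormula {m : ℕ} (φ : L.Formula (Fin n ⊕ Fin m)) {y : Fin m → C}
    (hy : ∀ i, y i ∈ B) :
    EqDefinable (realSet L B) ((EqFormula.ofFormula φ).solutions (realTuple L y)) := by
  have h1 : DefOver (realSet L B) {w : Fin n → C | ∃ z : Fin m → C, (∀ i, z i = y i) ∧
      (EqFormula.ofFormula φ).holds (realTuple L w) (realTuple L z)} := by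
    refine DefOver.exists' (P := fun (w : Fin n → C) (z : Fin m → C) => (∀ i, z i = y i) ∧
      (EqFormula.ofFormula φ).holds (realTuple L w) (realTuple L z)) ?_
    refine (DefOver.forall_finite fun i => DefOver.eq_const (realPt_mem_realSet.2 (hy i)) _).and ?_
    exact (EqFormula.ofFormula φ).defOver Sum.inl Sum.inr
  refine eqDefinable_iff.2 (h1.congr fun w => ?_)
  simp only [← funext_iff]
  exact ⟨fun h => ⟨y, rfl, h⟩, fun ⟨z, hz, h⟩ => hz ▸ h⟩

theorem typeThornForks_of_mem_acl {p : ℕ} {d : Fin p → C} {b : C} (hd : ∀ i, d i ∈ B) (hbB : b ∈ B)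
    (hb : b ∉ acl L (A ∪ Set.range d)) (hba : b ∈ acl L (Set.range d ∪ Set.range a)) :
    TypeThornForks (realTuple L a) (realSet L B) (realSet L A) := by
  rw [← Set.Sum.elim_range] at hba
  obtain ⟨N, φ, hφ, hφb⟩ := exists_formula_of_mem_acl hba
  let σ : Fin 1 ⊕ (Fin p ⊕ Fin n) → Fin n ⊕ Fin (p + 1) :=
    Sum.elim (fun _ => Sum.inr 0) (Sum.elim (fun i => Sum.inr i.succ) Sum.inl)
  have hσ : ∀ (x : Fin n → C) (y : Fin (p + 1) → C), Sum.elim x y ∘ σ =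
      Sum.elim (fun _ => y 0) (Sum.elim (fun i => y i.succ) x) := by
    intro x y
    ext1 z
    rcases z with z | z | z <;> rfl
  let δ := EqFormula.ofFormula (C := C) (φ.relabel σ)
  have hδ : ∀ x y, δ.holds (realTuple L x) (realTuple L y) ↔
      φ.Realize (Sum.elim (fun _ => y 0) (Sum.elim (fun i => y i.succ) x)) := by
    intro x y
    rw [EqFormula.ofFormula_holds_iff, Language.Formula.realize_relabel, hσ]
  have hay : realTuple L a ∈ δ.solutions (realTuple L (Fin.cons b d)) := (hδ _ _).2 hφb
  refine ⟨δ.solutions (realTuple L (Fin.cons b d)), EqFormula.eqDefinable_ofFormula _ ?_, hay,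
    1, fun _ => _, fun _ => δ, fun _ => realTuple L (Fin.cons b d), fun _ => ?_,
    fun x hx => Set.mem_iUnion.2 ⟨0, hx⟩⟩
  · exact fun i => Fin.cases hbB hd i
  refine ⟨tuplePt L d, fun hmem => hb ?_, N + 1, fun f hf hfP => ?_⟩
  · rw [← realPt_mem_aclEq_realSet]
    refine aclEq_subset_of_subset (Set.singleton_subset_iff.2 (aclEq_subset_of_subset ?_ hmem))
      (realPt_mem_aclEq_tuplePt (Fin.cons b d : Fin (p + 1) → C) 0)
    refine Set.insert_subset (tuplePt_mem_aclEq fun i => ?_) ?_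
    · exact realPt_mem_realSet.2 (Or.inr ⟨i, rfl⟩)
    · exact (realSet_mono Set.subset_union_left).trans (subset_aclEq _)
  · rintro ⟨x, hx⟩
    obtain ⟨x, rfl⟩ := realTuple_surjective n x
    choose g hg using fun i => realTuple_surjective (p + 1) (f i)
    have hgd : ∀ i, (fun j : Fin p => g i j.succ) = d := by
      intro i
      have h1 : RealizesType (insert (tuplePt L d) (realSet L A))
          (realTuple L (Fin.cons b d : Fin (p + 1) → C)) (realTuple L (g i)) := by
        rw [hg]
        exact hfP i
      have := (h1.mem_iff (W := {v | (realSort L C p).cls (v ∘ Fin.succ) = realTuple L d})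
        (DefOver.cls_eq_param (e := tuplePt L d) (Set.mem_insert _ _) _)).1 rfl
      exact realTuple_injective p this
    refine not_injective_of_encard_lt (k := N + 1) ((hφ (Sum.elim d x)).trans_lt ?_)
      (fun i => g i 0) (fun i j hij => hf ?_) fun i => ?_
    · exact_mod_cast Nat.lt_succ_self N
    · rw [← hg i, ← hg j]
      congr 1
      ext l
      refine Fin.cases hij (fun l => ?_) l
      exact congrFun ((hgd i).trans (hgd j).symm) l
    · have := hx i
      rw [← hg i, hδ, hgd i] at this
      exact this

theorem typeThornForks_of_mem_acl_union (hAB : A ⊆ B) (hTB : T ⊆ B) {b : C} (hbB : b ∈ B)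
    (hb : b ∉ acl L (A ∪ T)) (hba : b ∈ acl L (A ∪ T ∪ Set.range a)) :
    TypeThornForks (realTuple L a) (realSet L B) (realSet L A) := by
  classical
  obtain ⟨S, hS, hbS⟩ := exists_finite_of_mem_acl hba
  obtain ⟨d, hd⟩ := exists_range_eq_finset (S.filter (· ∈ A ∪ T))
  have hdAT : Set.range d ⊆ A ∪ T := by
    rw [hd]
    intro x hx
    exact (Finset.mem_filter.1 (Finset.mem_coe.1 hx)).2
  refine typeThornForks_of_mem_acl (d := d) (fun i => ?_) hbB (fun h => hb (acl_mono ?_ h))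
    (acl_mono ?_ hbS)
  · exact Set.union_subset hAB hTB (hdAT ⟨i, rfl⟩)
  · exact Set.union_subset Set.subset_union_left hdAT
  · intro x hx
    rcases hS hx with h | h
    · left
      rw [hd]
      exact Finset.mem_coe.2 (Finset.mem_filter.2 ⟨hx, h⟩)
    · exact Or.inr h

theorem exists_indepOver_not_indepOver_insert {I : Finset (Fin n)}
    (hI : IndepOver (realSet L A) a I) (S : Finset C) (hSB : (S : Set C) ⊆ B)
    (hIS : ¬ IndepOver (realSet L (A ∪ S)) a I) :
    ∃ T : Set C, T ⊆ B ∧ ∃ b ∈ B, IndepOver (realSet L (A ∪ T)) a I ∧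
      ¬ IndepOver (insert (realPt L b) (realSet L (A ∪ T))) a I := by
  classical
  induction S using Finset.induction_on with
  | empty => simp [hI] at hIS
  | insert b S _ ih =>
    rw [Finset.coe_insert] at hSB hIS
    by_cases h : IndepOver (realSet L (A ∪ S)) a I
    · refine ⟨S, (Set.subset_insert _ _).trans hSB, b, hSB (Set.mem_insert _ _), h, ?_⟩
      rwa [← realSet_insert, ← Set.union_insert]
    · exact ih ((Set.subset_insert _ _).trans hSB) h

theorem typeThornForks_of_dimGE (hex : SteinitzExchange L C) (hEI : GeometricEI L C) {k : ℕ}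
    (hA : DimGE (realSet L A) a k) (hAB : ¬ DimGE (realSet L (A ∪ B)) a k) :
    TypeThornForks (realTuple L a) (realSet L (A ∪ B)) (realSet L A) := by
  classical
  obtain ⟨I, rfl, hI⟩ := hA
  have hnot : ¬ IndepOver (realSet L (A ∪ B)) a I := fun h => hAB ⟨I, rfl, h⟩
  obtain ⟨S, hSB, hS⟩ : ∃ S : Finset C, (S : Set C) ⊆ B ∧
      ¬ IndepOver (realSet L (A ∪ S)) a I := by
    unfold IndepOver at hnot
    push Not at hnot
    obtain ⟨i, hi, hmem⟩ := hnot
    rw [← realSet_union, realPt_mem_aclEq_realSet] at hmem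
    obtain ⟨S, hS, hmem⟩ := exists_finite_of_mem_acl hmem
    refine ⟨S.filter (· ∈ B), fun x hx => (Finset.mem_filter.1 (Finset.mem_coe.1 hx)).2,
      fun h => h i hi ?_⟩
    rw [← realSet_union, realPt_mem_aclEq_realSet]
    refine acl_mono (fun x hx => ?_) hmem
    rcases hS hx with (h | h) | h
    · exact Or.inl (Or.inl h)
    · exact Or.inl (Or.inr (Finset.mem_coe.2 (Finset.mem_filter.2 ⟨hx, h⟩)))
    · exact Or.inr h
  obtain ⟨T, hTB, b, hbB, hT, hTb⟩ := exists_indepOver_not_indepOver_insert hI S hSB hS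
  refine typeThornForks_of_mem_acl_union (T := T) (b := b) Set.subset_union_left
    (hTB.trans Set.subset_union_right) (Or.inr hbB) (fun h => hTb ?_) ?_
  · refine hT.of_subset_aclEq (Set.insert_subset (realPt_mem_aclEq_realSet.2 h) (subset_aclEq _))
  · unfold IndepOver at hTb
    push Not at hTb
    obtain ⟨i, hi, hmem⟩ := hTb
    rw [Set.insert_union] at hmem
    have := realPt_mem_aclEq_exchange hex hEI hmem (hT i hi)
    rw [← realSet_union, ← realSet_insert, realPt_mem_aclEq_realSet] at this
    refine acl_mono ?_ this
    rintro x (rfl | h | ⟨j, -, rfl⟩)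
    · exact Or.inr ⟨i, rfl⟩
    · exact Or.inl h
    · exact Or.inr ⟨j, rfl⟩

end

section
variable {L : FirstOrder.Language.{v, w}} {C : Type u} [L.Structure C] {κ : Cardinal.{u}}

/-! ### The `U^þ`-rank -/

section Rank

variable {S : ImagSort L C}

theorem thornUGE_zero {A : Set (Imag L C)} {x : S.Elem} : ThornUGE κ S 0 A x := by
  unfold ThornUGE
  rw [Ordinal.limitRecOn_zero]
  trivial

theorem thornUGE_add_one {α : Ordinal.{u}} {A : Set (Imag L C)} {x : S.Elem} :
    ThornUGE κ S (α + 1) A x ↔ ∃ (B : Set (Imag L C)) (y : S.Elem), A ⊆ B ∧ #B < κ ∧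
      RealizesType A x y ∧ TypeThornForks y B A ∧ ThornUGE κ S α B y := by
  unfold ThornUGE
  rw [Ordinal.limitRecOn_add_one]

theorem thornUGE_limit {l : Ordinal.{u}} (hl : Order.IsSuccLimit l) {A : Set (Imag L C)}
    {x : S.Elem} : ThornUGE κ S l A x ↔ ∀ β < l, ThornUGE κ S β A x := by
  unfold ThornUGE
  rw [Ordinal.limitRecOn_limit _ _ _ _ hl]

theorem thornRankGE_zero {S' : ImagSort L C} {Δ : Set (EqFormula S S')}
    {Θ : Set (Σ S'' : ImagSort L C, EqFormula S' S'')} {k : ℕ} {X : Set S.Elem} :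
    ThornRankGE Δ Θ k (0 : Ordinal.{u}) X ↔ X.Nonempty := by
  unfold ThornRankGE
  rw [Ordinal.limitRecOn_zero]

theorem thornRankGE_add_one {S' : ImagSort L C} {Δ : Set (EqFormula S S')}
    {Θ : Set (Σ S'' : ImagSort L C, EqFormula S' S'')} {k : ℕ} {α : Ordinal.{u}} {X : Set S.Elem} :
    ThornRankGE Δ Θ k (α + 1) X ↔ ∃ δ ∈ Δ, ∃ π ∈ Θ, ∃ c : π.1.Elem,
      {a | π.2.holds a c ∧ ThornRankGE Δ Θ k α (X ∩ δ.solutions a)}.Infinite ∧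
        KInconsistent δ (π.2.solutions c) k := by
  unfold ThornRankGE
  rw [Ordinal.limitRecOn_add_one]

theorem thornRankGE_limit {S' : ImagSort L C} {Δ : Set (EqFormula S S')}
    {Θ : Set (Σ S'' : ImagSort L C, EqFormula S' S'')} {k : ℕ} {l : Ordinal.{u}}
    (hl : Order.IsSuccLimit l) {X : Set S.Elem} :
    ThornRankGE Δ Θ k l X ↔ ∀ β < l, ThornRankGE Δ Θ k β X := by
  unfold ThornRankGE
  rw [Ordinal.limitRecOn_limit _ _ _ _ hl]

end Rank

theorem natCast_lt_of_isSuccLimit {l : Ordinal.{u}} (hl : Order.IsSuccLimit l) (k : ℕ) :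
    (k : Ordinal.{u}) < l := by
  induction k with
  | zero => simpa using hl.bot_lt
  | succ k ih =>
    rw [Nat.cast_succ, ← Order.succ_eq_add_one]
    exact hl.succ_lt ih

variable {n : ℕ} {a : Fin n → C}

theorem ThornUGE.exists_dimGE (hC : IsMonster L C κ) (hex : SteinitzExchange L C)
    (hEI : GeometricEI L C) (α : Ordinal.{u}) : ∀ {A : Set (Imag L C)} {a : Fin n → C}, #A < κ →
      ThornUGE κ (realSort L C n) α A (realTuple L a) → ∃ k : ℕ, α = k ∧ DimGE A a k := by
  induction α using Ordinal.limitRecOn with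
  | zero => exact fun _ _ => ⟨0, by simp, .zero⟩
  | add_one α ih =>
    intro A a _ h
    obtain ⟨B, y, hAB, hB, hay, hfork, h⟩ := thornUGE_add_one.1 h
    obtain ⟨b, rfl⟩ := realTuple_surjective n y
    obtain ⟨k, rfl, hk⟩ := ih hB h
    exact ⟨k + 1, by simp,
      (hk.succ_of_typeThornForks hC hex hEI hAB hB hfork).of_realizesType hay.symm⟩
  | limit l hl ih =>
    intro A a hA h
    have hlt := natCast_lt_of_isSuccLimit hl (n + 1)
    obtain ⟨k, hk, hdim⟩ := ih _ hlt hA (((thornUGE_limit hl).1 h) _ hlt)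
    have := Nat.cast_injective hk
    exact absurd hdim.le (by omega)

theorem DimGE.thornUGE (hC : IsMonster L C κ) (hex : SteinitzExchange L C) (hEI : GeometricEI L C)
    {k : ℕ} : ∀ {B : Set C}, #B < κ → DimGE (realSet L B) a k →
      ThornUGE κ (realSort L C n) k (realSet L B) (realTuple L a) := by
  induction k with
  | zero =>
    intro B _ _
    rw [Nat.cast_zero]
    exact thornUGE_zero
  | succ k ih =>
    rintro B hB ⟨I, hIk, hI⟩
    obtain ⟨i, hi⟩ := Finset.card_pos.1 (by omega : 0 < I.card)
    rw [← Finset.insert_erase hi, indepOver_insert_iff hex hEI (Finset.notMem_erase i I)] at hI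
    have hB' := mk_insert_lt hC.aleph0_lt hB (a i)
    rw [Nat.cast_succ, thornUGE_add_one]
    refine ⟨realSet L (insert (a i) B), realTuple L a, realSet_mono (Set.subset_insert _ _),
      mk_image_le.trans_lt hB', fun X _ h => h, ?_, ih hB' ⟨I.erase i, ?_, ?_⟩⟩
    · refine typeThornForks_of_mem_acl_union (T := ∅) (b := a i) (Set.subset_insert _ _)
        (Set.empty_subset _) (Set.mem_insert _ _) ?_ ?_
      · rw [Set.union_empty, ← realPt_mem_aclEq_realSet]
        exact hI.1
      · exact subset_acl _ (Or.inr ⟨i, rfl⟩)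
    · rw [Finset.card_erase_of_mem hi, hIk, Nat.add_sub_cancel]
    · rw [realSet_insert]
      exact hI.2

theorem thornU_realTuple_eq (hC : IsMonster L C κ) (hex : SteinitzExchange L C)
    (hEI : GeometricEI L C) (a : Fin n → C) {B : Set C} (hB : #B < κ) :
    thornU κ (realSet L B) (realTuple L a) = ((algDim L B a : Ordinal.{u}) : WithTop Ordinal.{u}) := by
  refine le_antisymm (sSup_le ?_) (le_sSup ⟨_, rfl, ?_⟩)
  · rintro _ ⟨α, rfl, h⟩
    obtain ⟨k, rfl, hk⟩ := h.exists_dimGE hC hex hEI α (mk_image_le.trans_lt hB)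
    exact WithTop.coe_le_coe.2 (Nat.cast_le.2 (le_algDim_iff.2 hk))
  · exact DimGE.thornUGE hC hex hEI hB (le_algDim_iff.1 le_rfl)

theorem IsMonster.exists_notMem_acl_empty (hC : IsMonster L C κ) [Infinite C] :
    ∃ c : C, c ∉ acl L (∅ : Set C) := by
  obtain ⟨c, hc⟩ := hC.exists_forall_mem₁ (A := ∅)
    (mk_lt_of_finite hC.aleph0_lt Set.finite_empty)
    (ι := {X : Set C // (∅ : Set C).Definable₁ L X ∧ X.Finite}) (fun X => X.1ᶜ)
    (fun X => X.2.1.compl) (by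
      intro s
      obtain ⟨c, hc⟩ := (Set.Finite.biUnion s.finite_toSet fun X _ => X.2.2).exists_notMem
      exact ⟨c, fun X hX hcX => hc (Set.mem_biUnion hX hcX)⟩)
  exact ⟨c, fun ⟨X, hX, hfin, hcX⟩ => hc ⟨X, hX, hfin⟩ hcX⟩

theorem dimGE_singleton_iff {c : C} {A : Set (Imag L C)} :
    DimGE A (fun _ : Fin 1 => c) 1 ↔ realPt L c ∉ aclEq A := by
  constructor
  · rintro ⟨I, hI, h⟩
    obtain ⟨i, rfl⟩ := Finset.card_eq_one.1 hI
    exact fun hmem => h i (Finset.mem_singleton_self i) (aclEq_mono Set.subset_union_left hmem)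
  · refine fun h => ⟨{0}, rfl, fun i hi hmem => h ?_⟩
    rw [Finset.mem_singleton.1 hi, Finset.erase_singleton] at hmem
    simpa [realSet_empty] using hmem

theorem globalThornU_eq_one (hC : IsMonster L C κ) (hex : SteinitzExchange L C)
    (hEI : GeometricEI L C) [Infinite C] : globalThornU L C κ = 1 := by
  refine le_antisymm ?_ ?_
  · refine iSup_le fun A => iSup_le fun hA => iSup_le fun c => sSup_le ?_
    rintro _ ⟨α, rfl, h⟩
    obtain ⟨k, rfl, hk⟩ := h.exists_dimGE hC hex hEI α hA
    rw [← WithTop.coe_one, WithTop.coe_le_coe]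
    exact_mod_cast hk.le
  · obtain ⟨c, hc⟩ := hC.exists_notMem_acl_empty
    have h0 : #(∅ : Set C) < κ := mk_lt_of_finite hC.aleph0_lt Set.finite_empty
    have h1 : 1 ≤ thornU κ (realSet L ∅) (realTuple L fun _ : Fin 1 => c) := by
      rw [thornU_realTuple_eq hC hex hEI _ h0, ← WithTop.coe_one, WithTop.coe_le_coe]
      have : 1 ≤ algDim L (∅ : Set C) fun _ : Fin 1 => c := by
        rw [le_algDim_iff, dimGE_singleton_iff, realPt_mem_aclEq_realSet]
        exact hc
      exact_mod_cast this
    refine h1.trans ?_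
    exact le_iSup_of_le (realSet L ∅) (le_iSup_of_le (mk_image_le.trans_lt h0)
      (le_iSup (fun c => thornU κ (realSet L ∅) (realTuple L fun _ : Fin 1 => c)) c))

/-! ### þ-minimality and þ-independence -/

theorem thornMinimal (hC : IsMonster L C κ) (hex : SteinitzExchange L C)
    (hEI : GeometricEI L C) : ThornMinimal L C κ := by
  intro N hN a A
  have hA : #((fun x : N => (x : C)) '' A) < κ :=
    (mk_image_le.trans (mk_set_le A)).trans_lt hN
  have h0 : (a : C) ∉ acl L (∅ : Set C) ↔ a ∉ acl L (∅ : Set N) := by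
    rw [← coe_mem_acl_iff, Set.image_empty]
  rw [← coe_mem_acl_iff, ← h0]
  constructor
  · intro h
    have key : ∀ {k}, DimGE (realSet L ((fun x : N => (x : C)) '' A)) (fun _ : Fin 1 => (a : C)) k →
        DimGE ∅ (fun _ : Fin 1 => (a : C)) (k + 1) := fun hk =>
      hk.succ_of_typeThornForks hC hex hEI (Set.empty_subset _) (mk_image_le.trans_lt hA) h
    constructor
    · by_contra ha
      rw [← realPt_mem_aclEq_realSet, ← dimGE_singleton_iff] at ha
      exact absurd (key ha).le (by omega)
    · rw [← realPt_mem_aclEq_realSet, realSet_empty, ← dimGE_singleton_iff]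
      exact key .zero
  · rintro ⟨h1, h2⟩
    rw [← realPt_mem_aclEq_realSet, ← dimGE_singleton_iff] at h2
    rw [← realPt_mem_aclEq_realSet, ← not_iff_not.2 dimGE_singleton_iff |>.trans not_not] at h1
    rw [← Set.empty_union ((fun x : N => (x : C)) '' A)] at h1 ⊢
    have := typeThornForks_of_dimGE hex hEI h2 h1
    rwa [realSet_empty] at this

theorem thornIndepIffAlgIndep (hC : IsMonster L C κ) (hex : SteinitzExchange L C)
    (hEI : GeometricEI L C) : ThornIndepIffAlgIndep L C κ := by
  intro n a A B hA hB
  have hle : algDim L (A ∪ B) a ≤ algDim L A a :=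
    le_algDim_iff.2 ((le_algDim_iff.1 le_rfl).mono (realSet_mono Set.subset_union_left))
  constructor
  · intro h
    refine le_antisymm hle (le_algDim_iff.2 ?_)
    by_contra hdim
    exact h (typeThornForks_of_dimGE hex hEI (le_algDim_iff.1 le_rfl) hdim)
  · intro h hfork
    have := le_algDim_iff.2 (DimGE.succ_of_typeThornForks hC hex hEI
      (realSet_mono Set.subset_union_left)
      (mk_image_le.trans_lt (mk_union_lt hC.aleph0_lt hA hB)) (le_algDim_iff.1 le_rfl) hfork)
    omega

end

section
variable {L : FirstOrder.Language.{v, w}} {C : Type u} [L.Structure C] {κ : Cardinal.{u}}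
variable {S S' S'' : ImagSort L C} {A D : Set (Imag L C)}

/-! ### Rosiness -/

theorem EqDefinable.exists_finite {X : Set S.Elem} (h : EqDefinable A X) :
    ∃ B : Set (Imag L C), B.Finite ∧ EqDefinable B X := by
  obtain ⟨m, e, he, h⟩ := h
  exact ⟨Set.range e, Set.finite_range e, m, e, fun i => ⟨i, rfl⟩, h⟩

theorem EqFormula.eqDefinable_solutions (δ : EqFormula S S') {y : S'.Elem}
    (hy : (⟨S', y⟩ : Imag L C) ∈ A) : EqDefinable A (δ.solutions y) := by
  have h1 : DefOver A {w : Fin S.arity → C | ∃ z : Fin S'.arity → C,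
      S'.cls z = y ∧ δ.holds (S.cls w) (S'.cls z)} := by
    refine DefOver.exists' (P := fun (w : Fin S.arity → C) (z : Fin S'.arity → C) =>
      S'.cls z = y ∧ δ.holds (S.cls w) (S'.cls z)) ?_
    exact (DefOver.cls_eq_param hy _).and (δ.defOver _ _)
  refine eqDefinable_iff.2 (h1.congr fun w => ⟨fun h => ?_, ?_⟩)
  · obtain ⟨z, rfl⟩ := S'.exists_cls_eq y
    exact ⟨z, rfl, h⟩
  · rintro ⟨z, rfl, h⟩
    exact h

theorem cls_mem_aclEq {w : Fin S.arity → C} (h : ∀ i, realPt L (w i) ∈ A) :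
    (⟨S, S.cls w⟩ : Imag L C) ∈ aclEq A := by
  have h1 : DefOver A {v : Fin S.arity → C | ∃ z : Fin S.arity → C,
      (∀ i, z i = w i) ∧ S.cls v = S.cls z} := by
    refine DefOver.exists' (P := fun (v : Fin S.arity → C) (z : Fin S.arity → C) =>
      (∀ i, z i = w i) ∧ S.cls v = S.cls z) ?_
    exact (DefOver.forall_finite fun i => DefOver.eq_const (h i) _).and (DefOver.cls_eq _ _ _)
  refine ⟨{S.cls w}, eqDefinable_iff.2 (h1.congr fun v => ?_), Set.finite_singleton _, rfl⟩
  simp only [← funext_iff]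
  exact ⟨fun h => ⟨w, rfl, h⟩, fun ⟨z, hz, h⟩ => hz ▸ h⟩

/-- Failure of independence over a varying imaginary is witnessed by a formula. -/
theorem exists_defOver_of_not_indepOver {m : ℕ} {I : Finset (Fin m)}
    {v : Fin S.arity ⊕ Fin m → C}
    (hv : ¬ IndepOver (insert ⟨S, S.cls (v ∘ Sum.inl)⟩ D) (v ∘ Sum.inr) I) :
    ∃ W : Set (Fin S.arity ⊕ Fin m → C), DefOver D W ∧ v ∈ W ∧
      ∀ u ∈ W, ¬ IndepOver (insert ⟨S, S.cls (u ∘ Sum.inl)⟩ D) (u ∘ Sum.inr) I := by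
  unfold IndepOver at hv
  push Not at hv
  obtain ⟨i, hi, hmem⟩ := hv
  let T : Option (I.erase i) → ImagSort L C := fun o => o.elim S fun _ => realSort L C 1
  let h : ∀ t, Fin (T t).arity → Fin S.arity ⊕ Fin m := fun t =>
    Option.rec (motive := fun t => Fin (T t).arity → Fin S.arity ⊕ Fin m) Sum.inl
      (fun t _ => Sum.inr t) t
  have hT : ∀ u : Fin S.arity ⊕ Fin m → C,
      D ∪ Set.range (fun t => (⟨T t, (T t).cls (u ∘ h t)⟩ : Imag L C)) =
        insert ⟨S, S.cls (u ∘ Sum.inl)⟩ D ∪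
          realSet L ((u ∘ Sum.inr) '' (I.erase i : Finset (Fin m))) := by
    intro u
    have h1 : Set.range (fun t => (⟨T t, (T t).cls (u ∘ h t)⟩ : Imag L C)) =
        insert ⟨S, S.cls (u ∘ Sum.inl)⟩
          (realSet L ((u ∘ Sum.inr) '' (I.erase i : Finset (Fin m)))) := by
      rw [← range_realPt_eq]
      ext e
      constructor
      · rintro ⟨_ | t, rfl⟩
        · exact Or.inl rfl
        · exact Or.inr ⟨t, rfl⟩
      · rintro (rfl | ⟨t, rfl⟩)
        · exact ⟨none, rfl⟩
        · exact ⟨some t, rfl⟩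
    rw [h1, Set.union_insert, Set.insert_union]
  rw [← hT] at hmem
  obtain ⟨W, hW, hvW, hWmem⟩ := exists_defOver_of_mem_aclEq (realSort L C 1)
    (fun _ => Sum.inr i) T h v hmem
  refine ⟨W, hW, hvW, fun u hu hind => hind i hi ?_⟩
  rw [← hT]
  exact hWmem u hu

theorem IsMonster.exists_generic_indepOver (hC : IsMonster L C κ) (hD : #D < κ)
    {δ : EqFormula S S'} {X : Set S.Elem} (hX : EqDefinable D X) {Y : Set S'.Elem}
    (hY : EqDefinable D Y) {I : Finset (Fin S.arity)}
    (hinf : {y | y ∈ Y ∧ ∃ w, S.cls w ∈ X ∩ δ.solutions y ∧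
      IndepOver (insert ⟨S', y⟩ D) w I}.Infinite) :
    ∃ y ∈ Y, (⟨S', y⟩ : Imag L C) ∉ aclEq D ∧ ∃ w, S.cls w ∈ X ∩ δ.solutions y ∧
      IndepOver (insert ⟨S', y⟩ D) w I := by
  obtain ⟨u, hu⟩ := hC.exists_forall_mem (α := Fin S'.arity ⊕ Fin S.arity) hD
    (ι := {Z : Set S'.Elem // EqDefinable D Z ∧ Z.Finite} ⊕
      {W : Set (Fin S'.arity ⊕ Fin S.arity → C) // DefOver D W ∧ ∀ u ∈ W,
        ¬ IndepOver (insert ⟨S', S'.cls (u ∘ Sum.inl)⟩ D) (u ∘ Sum.inr) I})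
    (Sum.elim (fun Z => {u | S'.cls (u ∘ Sum.inl) ∉ Z.1 ∧ S'.cls (u ∘ Sum.inl) ∈ Y ∧
      S.cls (u ∘ Sum.inr) ∈ X ∧ δ.holds (S.cls (u ∘ Sum.inr)) (S'.cls (u ∘ Sum.inl))})
      fun W => W.1ᶜ) (by
      rintro (Z | W)
      · exact (Z.2.1.defOver.comp Sum.inl).not.and ((hY.defOver.comp Sum.inl).and
          ((hX.defOver.comp Sum.inr).and (δ.defOver _ _)))
      · exact W.2.1.compl) (by
      intro s
      obtain ⟨y, ⟨hyY, w, hw, hind⟩, hy⟩ := hinf.exists_notMem_finite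
        (Set.Finite.biUnion s.toLeft.finite_toSet fun Z _ => Z.2.2)
      obtain ⟨z, rfl⟩ := S'.exists_cls_eq y
      refine ⟨Sum.elim z w, ?_⟩
      rintro (Z | W) hj
      · exact ⟨fun hz => hy (Set.mem_biUnion (Finset.mem_coe.2 (Finset.mem_toLeft.2 hj)) hz), hyY,
          hw⟩
      · exact fun hW => W.2.2 _ hW hind)
  have h0 := hu (Sum.inl ⟨∅, eqDefinable_iff.2 (DefOver.const False), Set.finite_empty⟩)
  refine ⟨S'.cls (u ∘ Sum.inl), h0.2.1, ?_, u ∘ Sum.inr, h0.2.2, ?_⟩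
  · rintro ⟨Z, hZ, hfin, huZ⟩
    exact (hu (Sum.inl ⟨Z, hZ, hfin⟩)).1 huZ
  · by_contra hnot
    obtain ⟨W, hW, huW, hbad⟩ := exists_defOver_of_not_indepOver hnot
    exact hu (Sum.inr ⟨W, hW, hbad⟩) huW

theorem IsMonster.exists_dimGE_succ (hC : IsMonster L C κ) (hex : SteinitzExchange L C)
    (hEI : GeometricEI L C) {δ : EqFormula S S'} {X : Set S.Elem} (hX : EqDefinable Set.univ X)
    {π : EqFormula S' S''} {c : S''.Elem} {j k : ℕ}
    (hinf : {y | π.holds y c ∧ ∀ D : Set (Imag L C), #D < κ →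
      ∃ w, S.cls w ∈ X ∩ δ.solutions y ∧ DimGE D w j}.Infinite)
    (hk : KInconsistent δ (π.solutions c) k) (hD : #D < κ) :
    ∃ w, S.cls w ∈ X ∧ DimGE D w (j + 1) := by
  obtain ⟨B, hB, hX⟩ := hX.exists_finite
  let E : Set (Imag L C) := insert ⟨S'', c⟩ (D ∪ B)
  have hEκ : #E < κ := mk_insert_lt hC.aleph0_lt
    (mk_union_lt hC.aleph0_lt hD (mk_lt_of_finite hC.aleph0_lt hB)) _
  have hDE : D ⊆ E := Set.subset_union_left.trans (Set.subset_insert _ _)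
  have hXE : EqDefinable E X := hX.mono (Set.subset_union_right.trans (Set.subset_insert _ _))
  have hπ : EqDefinable E (π.solutions c) := π.eqDefinable_solutions (Set.mem_insert _ _)
  obtain ⟨I, hIj, hI⟩ : ∃ I : Finset (Fin S.arity), I.card = j ∧
      {y | y ∈ π.solutions c ∧ ∃ w, S.cls w ∈ X ∩ δ.solutions y ∧
        IndepOver (insert ⟨S', y⟩ E) w I}.Infinite := by
    by_contra! hfin
    refine hinf ((Set.finite_iUnion fun I : {I : Finset (Fin S.arity) // I.card = j} =>
      hfin I.1 I.2).subset ?_)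
    rintro y ⟨hy, hyD⟩
    obtain ⟨w, hw, I, hIj, hI⟩ := hyD _ (mk_insert_lt hC.aleph0_lt hEκ ⟨S', y⟩)
    exact Set.mem_iUnion.2 ⟨⟨I, hIj⟩, hy, w, hw, hI⟩
  obtain ⟨y, hy, hyE, w, hw, hind⟩ := hC.exists_generic_indepOver hEκ hXE hπ hI
  refine ⟨w, hw.1, DimGE.mono ?_ hDE⟩
  by_contra hmax
  have hspan := (hind.mono (Set.subset_insert _ _)).spans hex hEI (hIj ▸ hmax)
  refine notMem_of_indepOver_insert hex hEI hyE hind ?_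
  have hwmem : (⟨S, S.cls w⟩ : Imag L C) ∈ aclEq (E ∪ realSet L (w '' I)) := by
    rw [← aclEq_idem]
    exact cls_mem_aclEq hspan
  have hyw : (⟨S', y⟩ : Imag L C) ∈ aclEq (insert ⟨S, S.cls w⟩ E) :=
    ⟨_, δ.eqDefinable_and_holds (Set.mem_insert _ _) (hπ.mono (Set.subset_insert _ _)),
      Set.finite_of_encard_le_coe (hk.encard_le _), hy, hw.2⟩
  exact aclEq_subset_of_subset (Set.insert_subset hwmem
    (Set.subset_union_left.trans (subset_aclEq _))) hyw

theorem ThornRankGE.exists_dimGE (hC : IsMonster L C κ) (hex : SteinitzExchange L C)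
    (hEI : GeometricEI L C) {Δ : Set (EqFormula S S')}
    {Θ : Set (Σ S'' : ImagSort L C, EqFormula S' S'')} {k : ℕ} (α : Ordinal.{u}) :
    ∀ {X : Set S.Elem}, EqDefinable Set.univ X → ThornRankGE Δ Θ k α X →
      ∃ j : ℕ, α = j ∧ ∀ D : Set (Imag L C), #D < κ → ∃ w, S.cls w ∈ X ∧ DimGE D w j := by
  induction α using Ordinal.limitRecOn with
  | zero =>
    intro X _ h
    obtain ⟨x, hx⟩ := thornRankGE_zero.1 h
    obtain ⟨w, rfl⟩ := S.exists_cls_eq x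
    exact ⟨0, by simp, fun D _ => ⟨w, hx, .zero⟩⟩
  | add_one α ih =>
    intro X hX h
    obtain ⟨δ, -, π, -, c, hinf, hk⟩ := thornRankGE_add_one.1 h
    have hXδ : ∀ y, EqDefinable Set.univ (X ∩ δ.solutions y) := fun y =>
      eqDefinable_iff.2 (hX.defOver.and (δ.eqDefinable_solutions (Set.mem_univ _)).defOver)
    obtain ⟨y, -, hy⟩ := hinf.nonempty
    obtain ⟨j, rfl, -⟩ := ih (hXδ y) hy
    refine ⟨j + 1, by simp, fun D hD => hC.exists_dimGE_succ hex hEI hX (hinf.mono ?_) hk hD⟩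
    rintro y ⟨hyc, hy⟩
    obtain ⟨i, hi, hdim⟩ := ih (hXδ y) hy
    rw [Nat.cast_injective hi]
    exact ⟨hyc, hdim⟩
  | limit l hl ih =>
    intro X hX h
    have hlt := natCast_lt_of_isSuccLimit hl (S.arity + 1)
    obtain ⟨j, hj, hdim⟩ := ih _ hlt hX ((thornRankGE_limit hl).1 h _ hlt)
    obtain ⟨w, -, hw⟩ := hdim ∅ (mk_lt_of_finite hC.aleph0_lt Set.finite_empty)
    have := Nat.cast_injective hj
    exact absurd hw.le (by omega)

theorem rosy (hC : IsMonster L C κ) (hex : SteinitzExchange L C) (hEI : GeometricEI L C) :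
    Rosy L C := by
  intro S S' X hX Δ Θ k
  refine ⟨(S.arity + 1 : ℕ), fun h => ?_⟩
  obtain ⟨j, hj, hdim⟩ := h.exists_dimGE hC hex hEI _ hX
  obtain ⟨w, -, hw⟩ := hdim ∅ (mk_lt_of_finite hC.aleph0_lt Set.finite_empty)
  have := Nat.cast_injective hj
  exact absurd hw.le (by omega)

end

end ThornForking

open ThornForking

theorem mainTheorem5 (L : FirstOrder.Language.{v, w}) (C : Type u) [L.Structure C] (κ : Cardinal.{u})
    (hC : IsMonster L C κ) (M : L.ElementarySubstructure C) (hMκ : #M < κ)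
    (hsat : WeaklyOmegaSaturated M) (hexch : SteinitzExchange L M) (hEI : GeometricEI L C) :
    ThornMinimal L C κ ∧
    (Infinite M → globalThornU L C κ = 1) ∧
    (∀ (n : ℕ) (a : Fin n → C) (B : Set C), #B < κ →
      thornU κ (realSet L B) (realTuple L a) = ((algDim L B a : Ordinal.{u}) : WithTop Ordinal.{u})) ∧
    Rosy L C ∧
    ThornIndepIffAlgIndep L C κ := by
  have hex := hsat.steinitzExchange hexch
  refine ⟨thornMinimal hC hex hEI, fun _ => ?_, fun n a B hB => thornU_realTuple_eq hC hex hEI a hB,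
    rosy hC hex hEI, thornIndepIffAlgIndep hC hex hEI⟩
  have : Infinite C := Infinite.of_injective (fun x : M => (x : C)) Subtype.val_injective
  exact globalThornU_eq_one hC hex hEI
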